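/- Let $Z, Z_1, Z_2, \ldots$ be i.i.d. random vectors in $\mathbb{R}^2$, let $S_0 := 0$ and $S_n := \sum_{k=1}^n Z_k$ for $n \geq 1$, and let $L_n$ be the perimeter length of the convex hull of $\{S_0, S_1, \ldots, S_n\}$ (where the perimeter length of a line segment is twice its length, and that of a point is $0$). Suppose that $\mathbb{E}(\|Z\|^2) < \infty$ and that $\mu := \mathbb{E} Z \neq 0$, where $\|\cdot\|$ is the Euclidean norm. Put $\hat\mu := \mu/\|\mu\|$ and $$\sigma^2_{\mu_\perp} := \mathbb{E}(\|Z-\mu\|^2) - \mathbb{E}\big[((Z-\mu)\cdot\hat\mu)^2\big].$$ Then $\mathbb{E} L_n < \infty$ for every $n$ and, as $n \to \infty$, $$\mathbb{E} L_n = 2\|\mu\| n + \left(\frac{\sigma^2_{\mu_\perp}}{\|\mu\|} + o(1)\right) \log n .$$ -/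

import Mathlib

open MeasureTheory ProbabilityTheory Filter Topology

namespace PlanarWalk

/-- The Euclidean plane. -/
abbrev Plane : Type := EuclideanSpace ℝ (Fin 2)

open Classical in
/-- Perimeter length of a planar compact convex set `K`: the length (one-dimensional Hausdorff
measure) of the boundary of `K` if `K` has interior points. Otherwise `K` is a point or a line
segment, whose boundary curve runs along the segment twice, so that the perimeter length is twice
the length of the segment. -/
noncomputable def perimeter (K : Set Plane) : ℝ :=
  if (interior K).Nonempty then (Measure.hausdorffMeasure 1 (frontier K)).toReal
  else 2 * (Measure.hausdorffMeasure 1 K).toReal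

variable {Ω : Type*}

/-- The walk `S_n = Z_1 + ⋯ + Z_n` (so `S_0 = 0`); the step `Z_{k+1}` is `Z k`. -/
noncomputable def walk (Z : ℕ → Ω → Plane) (n : ℕ) (ω : Ω) : Plane :=
  ∑ k ∈ Finset.range n, Z k ω

/-- The convex hull of `S_0, S_1, …, S_n`. -/
def hull (Z : ℕ → Ω → Plane) (n : ℕ) (ω : Ω) : Set Plane :=
  convexHull ℝ ((fun k => walk Z k ω) '' Set.Iic n)

/-- The perimeter length `L_n` of the convex hull of `S_0, S_1, …, S_n`. -/
noncomputable def perimeterLength (Z : ℕ → Ω → Plane) (n : ℕ) (ω : Ω) : ℝ :=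
  perimeter (hull Z n ω)

/-- `σ² = E ‖ξ - E ξ‖²`. -/
noncomputable def totalVariance [MeasurableSpace Ω] (P : Measure Ω) (ξ : Ω → Plane) : ℝ :=
  ∫ ω, ‖ξ ω - ∫ ω', ξ ω' ∂P‖ ^ 2 ∂P

/-- `E [((ξ - μ) · μ̂)²]` where `μ = E ξ` and `μ̂ = μ / ‖μ‖`; used for `μ ≠ 0`. -/
noncomputable def parallelVariance [MeasurableSpace Ω] (P : Measure Ω) (ξ : Ω → Plane) : ℝ :=
  ∫ ω, (inner ℝ (ξ ω - ∫ ω', ξ ω' ∂P)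
    (‖∫ ω', ξ ω' ∂P‖⁻¹ • ∫ ω', ξ ω' ∂P)) ^ 2 ∂P

/-- `σ² - E [((ξ - μ) · μ̂)²]`. -/
noncomputable def perpVariance [MeasurableSpace Ω] (P : Measure Ω) (ξ : Ω → Plane) : ℝ :=
  totalVariance P ξ - parallelVariance P ξ

end PlanarWalk

/-!
Three facts give the asymptotics of the mean perimeter.

*Cauchy's formula* (`perimeter_convexHull`): the perimeter of the convex hull of finitely many
points is the integral over `θ ∈ [0, π]` of its width in direction `θ`. It follows from Crofton's
formula (`crofton`) for sets covered by finitely many lines, which reduces to the behaviour of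
length under projection of a line to a line. A line through the interior of a polygon meets the
boundary in exactly two points (`count_frontier_inter_fiber`), and the boundary is covered by the
lines through pairs of vertices. A hull without interior points lies on a line, and its length is
computed directly from its projections.

*The Spitzer–Widom formula* (`integral_len_eq_sum`): `E L_n = ∑_{k ≤ n} 2 E ‖S_k‖ / k`. When the
last step of a path is added, the support function in direction `e` grows by some amount; the sum
of these amounts over all cyclic rotations of the steps is the positive part of `⟪S_n, e⟫`, since
for the periodically continued walk they are differences of the maxima over successive windows
(`sum_rotations_supp`). Integrating over directions, and using that an i.i.d. law is invariant under
rotations of the indices, gives `E L_n - E L_{n-1} = 2 E ‖S_n‖ / n`.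

*The mean distance from the origin* (`tendsto_integral_norm_walk`):
`E ‖S_n‖ - n ‖μ‖ → σ² / (2 ‖μ‖)`, where `σ²` is the variance orthogonal to the drift. The norm
exceeds the component along the drift by about `Y ^ 2 / (2 n ‖μ‖)`, where `Y` is the orthogonal
component. The events where this expansion fails have vanishing probability and are negligible
because the squared normalized sums are uniformly integrable (`tendsto_setIntegral_sum_sq`).

Summing, `E L_n = 2 ‖μ‖ n + ∑_{k ≤ n} (σ² / ‖μ‖ + o(1)) / k`, and the harmonic sum is `log n`.
-/

open scoped Pointwise

namespace PlanarWalk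

/-! ### Directions in the plane -/

/-- The unit vector with polar angle `θ`. -/
noncomputable def dir (θ : ℝ) : Plane := !₂[Real.cos θ, Real.sin θ]

lemma inner_plane (x y : Plane) : inner ℝ x y = x 0 * y 0 + x 1 * y 1 := by
  simp [PiLp.inner_apply, Fin.sum_univ_two, mul_comm]

lemma inner_dir (x : Plane) (θ : ℝ) :
    inner ℝ x (dir θ) = x 0 * Real.cos θ + x 1 * Real.sin θ := by
  simp [inner_plane, dir]

lemma norm_dir (θ : ℝ) : ‖dir θ‖ = 1 := by
  simp [EuclideanSpace.norm_eq, Fin.sum_univ_two, dir]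

lemma continuous_dir : Continuous dir := by
  unfold dir
  fun_prop

lemma exists_eq_norm_smul_dir (x : Plane) : ∃ φ, x = ‖x‖ • dir φ := by
  have hn : ‖x‖ = ‖(⟨x 0, x 1⟩ : ℂ)‖ := by
    rw [EuclideanSpace.norm_eq, Complex.norm_eq_sqrt_sq_add_sq]
    simp [Fin.sum_univ_two]
  refine ⟨Complex.arg ⟨x 0, x 1⟩, ?_⟩
  ext i
  fin_cases i
  · simp [dir, hn, Complex.norm_mul_cos_arg]
  · simp [dir, hn, Complex.norm_mul_sin_arg]

lemma exists_inner_dir_eq (x : Plane) :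
    ∃ φ, ∀ θ, inner ℝ x (dir θ) = ‖x‖ * Real.cos (θ - φ) := by
  obtain ⟨φ, hφ⟩ := exists_eq_norm_smul_dir x
  refine ⟨φ, fun θ => ?_⟩
  conv_lhs => rw [hφ]
  rw [real_inner_smul_left, inner_dir, Real.cos_sub]
  simp only [dir, PiLp.toLp_apply, Matrix.cons_val_zero, Matrix.cons_val_one]
  ring

lemma integral_abs_inner_dir (x : Plane) :
    ∫ θ in (0 : ℝ)..Real.pi, |inner ℝ x (dir θ)| = 2 * ‖x‖ := by
  obtain ⟨φ, hφ⟩ := exists_inner_dir_eq x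
  have hper : Function.Periodic (fun θ : ℝ => |Real.cos θ|) Real.pi := by
    intro θ
    simp [Real.cos_add_pi]
  have h2 : ∫ θ in (0 : ℝ)..Real.pi, |Real.cos (θ - φ)| = 2 := by
    rw [intervalIntegral.integral_comp_sub_right (fun θ => |Real.cos θ|) φ]
    have := hper.intervalIntegral_add_eq (0 - φ) (-(Real.pi / 2))
    rw [show 0 - φ + Real.pi = Real.pi - φ by ring] at this
    rw [this, show -(Real.pi / 2) + Real.pi = Real.pi / 2 by ring]
    have hcongr : ∫ θ in (-(Real.pi / 2))..(Real.pi / 2), |Real.cos θ| =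
        ∫ θ in (-(Real.pi / 2))..(Real.pi / 2), Real.cos θ := by
      refine intervalIntegral.integral_congr fun θ hθ => ?_
      rw [Set.uIcc_of_le (by linarith [Real.pi_pos])] at hθ
      exact abs_of_nonneg (Real.cos_nonneg_of_mem_Icc hθ)
    rw [hcongr, integral_cos]
    simp
    norm_num
  simp_rw [hφ, abs_mul, abs_norm]
  rw [intervalIntegral.integral_const_mul, h2]
  ring

lemma lintegral_abs_inner_dir (x : Plane) :
    ∫⁻ θ in Set.Ioc (0 : ℝ) Real.pi, ENNReal.ofReal |inner ℝ x (dir θ)| =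
      2 * ENNReal.ofReal ‖x‖ := by
  have hc : Continuous fun θ => |inner ℝ x (dir θ)| := by
    have := continuous_dir
    fun_prop
  rw [← ofReal_integral_eq_lintegral_ofReal
    (hc.integrableOn_Ioc) (Eventually.of_forall fun θ => abs_nonneg _),
    ← intervalIntegral.integral_of_le Real.pi_pos.le, integral_abs_inner_dir,
    ENNReal.ofReal_mul (by norm_num)]
  simp

lemma ae_inner_dir_ne_zero {x : Plane} (hx : x ≠ 0) : ∀ᵐ θ : ℝ, inner ℝ x (dir θ) ≠ 0 := by
  obtain ⟨φ, hφ⟩ := exists_inner_dir_eq x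
  have hcount : {θ : ℝ | inner ℝ x (dir θ) = 0}.Countable := by
    refine (Set.countable_range fun k : ℤ => (2 * k + 1) * Real.pi / 2 + φ).mono ?_
    intro θ hθ
    rw [Set.mem_ofPred_eq, hφ, mul_eq_zero, or_iff_right (norm_ne_zero_iff.2 hx),
      Real.cos_eq_zero_iff] at hθ
    obtain ⟨k, hk⟩ := hθ
    exact ⟨k, by simp only []; linarith⟩
  exact measure_mono_null (fun θ hθ => not_not.1 hθ) (hcount.measure_zero volume)

/-- The orthogonal complement of a nonzero vector of the plane is spanned by each of its nonzero
elements. -/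
lemma exists_eq_smul_of_inner_eq_zero {z w e : Plane} (he : e ≠ 0) (hw : w ≠ 0)
    (hze : inner ℝ z e = 0) (hwe : inner ℝ w e = 0) : ∃ s : ℝ, z = s • w := by
  rw [inner_plane] at hze hwe
  have hdet : z 0 * w 1 - z 1 * w 0 = 0 := by
    have h0 : e 0 * (z 0 * w 1 - z 1 * w 0) = 0 := by linear_combination w 1 * hze - z 1 * hwe
    have h1 : e 1 * (z 0 * w 1 - z 1 * w 0) = 0 := by linear_combination z 0 * hwe - w 0 * hze
    by_contra hne
    apply he
    ext i
    fin_cases i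
    · simpa [hne] using h0
    · simpa [hne] using h1
  have hpos : w 0 ^ 2 + w 1 ^ 2 ≠ 0 := by
    intro h
    apply hw
    ext i
    fin_cases i
    · simp; nlinarith [sq_nonneg (w 0), sq_nonneg (w 1)]
    · simp; nlinarith [sq_nonneg (w 0), sq_nonneg (w 1)]
  refine ⟨(z 0 * w 0 + z 1 * w 1) / (w 0 ^ 2 + w 1 ^ 2), ?_⟩
  ext i
  fin_cases i
  · simp only [Fin.zero_eta, Fin.isValue, PiLp.smul_apply, smul_eq_mul]
    rw [div_mul_eq_mul_div, eq_div_iff hpos]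
    linear_combination w 1 * hdet
  · simp only [Fin.mk_one, Fin.isValue, PiLp.smul_apply, smul_eq_mul]
    rw [div_mul_eq_mul_div, eq_div_iff hpos]
    linear_combination -w 0 * hdet

/-! ### Crofton's formula for sets covered by finitely many lines -/

/-- The line through `a` with direction `v`. -/
def line (a v : Plane) : Set Plane := Set.range fun s : ℝ => a + s • v

lemma isometry_line (a : Plane) {v : Plane} (hv : ‖v‖ = 1) :
    Isometry fun s : ℝ => a + s • v := by
  refine Isometry.of_dist_eq fun s t => ?_
  rw [dist_add_left, dist_eq_norm, ← sub_smul, norm_smul, hv, mul_one, Real.dist_eq,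
    Real.norm_eq_abs]

lemma isClosed_line (a : Plane) {v : Plane} (hv : ‖v‖ = 1) : IsClosed (line a v) :=
  (isometry_line a hv).isClosedEmbedding.isClosed_range

lemma injOn_inner_line {a v e : Plane} (h : inner ℝ v e ≠ 0) :
    Set.InjOn (fun x : Plane => inner ℝ x e) (line a v) := by
  rintro _ ⟨s, rfl⟩ _ ⟨t, rfl⟩ hst
  simp only [inner_add_left, inner_smul_left, add_right_inj] at hst
  have : s = t := mul_right_cancel₀ h (by simpa using hst)
  rw [this]

/-- The projection of a subset of a line to a second line scales length by the absolute value of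
the cosine of the angle. -/
lemma volume_image_inner {a v : Plane} (hv : ‖v‖ = 1) (e : Plane) {B : Set Plane}
    (hB : B ⊆ line a v) :
    volume ((fun x : Plane => inner ℝ x e) '' B) =
      ENNReal.ofReal |inner ℝ v e| * Measure.hausdorffMeasure 1 B := by
  obtain ⟨A, rfl⟩ := Set.subset_range_iff_exists_image_eq.1 hB
  rw [(isometry_line a hv).hausdorffMeasure_image (Or.inl zero_le_one), hausdorffMeasure_real,
    Set.image_image]
  have himg : (fun s : ℝ => inner ℝ (a + s • v) e) '' A =
      (fun t => inner ℝ a e + t) '' ((inner ℝ v e : ℝ) • A) := by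
    rw [← Set.image_smul, Set.image_image]
    refine Set.image_congr fun s _ => ?_
    simp [inner_add_left, inner_smul_left, mul_comm]
  rw [himg, Set.image_add_left, measure_preimage_add, Measure.addHaar_smul]
  simp

lemma two_mul_hausdorffMeasure_of_subset_line {a v : Plane} (hv : ‖v‖ = 1) {B : Set Plane}
    (hB : B ⊆ line a v) :
    2 * Measure.hausdorffMeasure 1 B =
      ∫⁻ θ in Set.Ioc (0 : ℝ) Real.pi, volume ((fun x : Plane => inner ℝ x (dir θ)) '' B) := by
  have hc : Continuous fun θ => |inner ℝ v (dir θ)| := by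
    have := continuous_dir
    fun_prop
  simp_rw [volume_image_inner hv _ hB]
  rw [lintegral_mul_const _ hc.measurable.ennreal_ofReal,
    lintegral_abs_inner_dir, hv]
  simp

/-- For a subset of a line and a direction not orthogonal to it, the number of points above each
point of the projection is `0` or `1`. -/
lemma count_fiber_of_subset_line {a v e : Plane} (h : inner ℝ v e ≠ 0) {B : Set Plane}
    (hB : B ⊆ line a v) (t : ℝ) :
    Measure.count (B ∩ {x : Plane | inner ℝ x e = t}) =
      ((fun x : Plane => inner ℝ x e) '' B).indicator 1 t := by
  by_cases ht : t ∈ (fun x : Plane => inner ℝ x e) '' B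
  · obtain ⟨x, hx, rfl⟩ := ht
    have : B ∩ {y : Plane | inner ℝ y e = inner ℝ x e} = {x} := by
      ext y
      constructor
      · rintro ⟨hy, hyx⟩
        exact injOn_inner_line h (hB hy) (hB hx) hyx
      · rintro rfl
        exact ⟨hx, rfl⟩
    rw [Set.indicator_of_mem (Set.mem_image_of_mem _ hx)]
    simp [this]
  · have : B ∩ {y : Plane | inner ℝ y e = t} = ∅ := by
      ext y
      simp only [Set.mem_inter_iff, Set.mem_ofPred_eq, Set.mem_empty_iff_false, iff_false, not_and]
      exact fun hy hyt => ht ⟨y, hy, hyt⟩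
    rw [Set.indicator_of_notMem ht, this, measure_empty]

lemma measurableSet_image_inner {a v e : Plane} (h : inner ℝ v e ≠ 0) {B : Set Plane}
    (hB : B ⊆ line a v) (hBm : MeasurableSet B) :
    MeasurableSet ((fun x : Plane => inner ℝ x e) '' B) :=
  hBm.image_of_continuousOn_injOn (by fun_prop) ((injOn_inner_line h).mono hB)

/-- Crofton's formula: the length of a measurable set `F` covered by finitely many lines is half
the integral, over all lines, of the number of intersection points with `F`. -/
theorem crofton {m : ℕ} {a v : Fin m → Plane} (hv : ∀ j, ‖v j‖ = 1) {F : Set Plane}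
    (hF : MeasurableSet F) (hcov : F ⊆ ⋃ j, line (a j) (v j)) :
    2 * Measure.hausdorffMeasure 1 F =
      ∫⁻ θ in Set.Ioc (0 : ℝ) Real.pi, ∫⁻ t : ℝ,
        Measure.count (F ∩ {x : Plane | inner ℝ x (dir θ) = t}) := by
  -- Disjoint pieces of `F`, one in each line.
  set f : Fin m → Set Plane := fun j => F ∩ line (a j) (v j) with hf
  have hfm : ∀ j, MeasurableSet (f j) := fun j => hF.inter (isClosed_line _ (hv j)).measurableSet
  set B := disjointed f with hBdef
  have hBm : ∀ j, MeasurableSet (B j) := fun j => by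
    rw [hBdef]
    exact disjointedRec (fun {t i} ht => ht.diff (hfm i)) (hfm j)
  have hBl : ∀ j, B j ⊆ line (a j) (v j) := fun j =>
    (disjointed_subset f j).trans Set.inter_subset_right
  have hBd : Pairwise (Function.onFun Disjoint B) := disjoint_disjointed f
  have hBu : F = ⋃ j, B j := by
    rw [hBdef, iUnion_disjointed, hf, ← Set.inter_iUnion]
    exact (Set.inter_eq_left.2 hcov).symm
  have hfib : ∀ (θ t : ℝ), MeasurableSet {x : Plane | inner ℝ x (dir θ) = t} := fun θ t =>
    (isClosed_eq (by fun_prop) continuous_const).measurableSet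
  have hcount : ∀ θ t : ℝ, Measure.count (F ∩ {x : Plane | inner ℝ x (dir θ) = t}) =
      ∑ j, Measure.count (B j ∩ {x : Plane | inner ℝ x (dir θ) = t}) := by
    intro θ t
    rw [hBu, Set.iUnion_inter, measure_iUnion, tsum_fintype]
    · intro i j hij
      exact (hBd hij).mono Set.inter_subset_left Set.inter_subset_left
    · exact fun j => (hBm j).inter (hfib θ t)
  have hae : ∀ᵐ θ : ℝ, ∀ j, inner ℝ (v j) (dir θ) ≠ 0 :=
    ae_all_iff.2 fun j => ae_inner_dir_ne_zero (norm_ne_zero_iff.1 (by rw [hv j]; norm_num))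
  have hinner : ∀ᵐ θ : ℝ, ∫⁻ t : ℝ, Measure.count (F ∩ {x : Plane | inner ℝ x (dir θ) = t}) =
      ∑ j, volume ((fun x : Plane => inner ℝ x (dir θ)) '' B j) := by
    filter_upwards [hae] with θ hθ
    simp_rw [hcount, fun j => count_fiber_of_subset_line (hθ j) (hBl j)]
    rw [lintegral_finsetSum _ fun j _ => measurable_one.indicator
      (measurableSet_image_inner (hθ j) (hBl j) (hBm j))]
    exact Finset.sum_congr rfl fun j _ => lintegral_indicator_one
      (measurableSet_image_inner (hθ j) (hBl j) (hBm j))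
  rw [lintegral_congr_ae (ae_restrict_of_ae hinner), lintegral_finsetSum]
  · simp_rw [← fun j => two_mul_hausdorffMeasure_of_subset_line (hv j) (hBl j)]
    rw [← Finset.mul_sum, ← tsum_fintype (L := .unconditional _), ← measure_iUnion hBd hBm, ← hBu]
  · intro j _
    have hc : Continuous fun θ => |inner ℝ (v j) (dir θ)| := by
      have := continuous_dir
      fun_prop
    simp_rw [fun θ => volume_image_inner (hv j) (dir θ) (hBl j)]
    exact hc.measurable.ennreal_ofReal.mul_const _

/-! ### Cauchy's formula for the perimeter of a polygon -/

/-- A line through an interior point of a bounded convex set meets the boundary in exactly two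
points. -/
lemma count_frontier_inter_fiber {K : Set Plane} (hK : Convex ℝ K) (hb : Bornology.IsBounded K)
    {y : Plane} (hy : y ∈ interior K) (θ : ℝ) :
    Measure.count (frontier K ∩ {x : Plane | inner ℝ x (dir θ) = inner ℝ y (dir θ)}) = 2 := by
  set u : Plane := dir (θ + Real.pi / 2) with hu
  have hu0 : u ≠ 0 := norm_ne_zero_iff.1 (by rw [hu, norm_dir]; norm_num)
  have huθ : inner ℝ u (dir θ) = 0 := by
    rw [hu, inner_dir]
    simp [dir, Real.cos_add_pi_div_two, Real.sin_add_pi_div_two]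
    ring
  have hθ0 : dir θ ≠ 0 := norm_ne_zero_iff.1 (by rw [norm_dir]; norm_num)
  -- After translation by `-y`, boundary points are those with gauge `1`.
  set K₀ : Set Plane := (Homeomorph.addLeft y) ⁻¹' K with hK₀
  have hK₀c : Convex ℝ K₀ := hK.translate_preimage_right y
  have hK₀n : K₀ ∈ 𝓝 (0 : Plane) := by
    have : K ∈ 𝓝 ((Homeomorph.addLeft y) 0) := by
      simpa using mem_interior_iff_mem_nhds.1 hy
    exact (Homeomorph.addLeft y).continuous.continuousAt this
  have hK₀b : Bornology.IsVonNBounded ℝ K₀ := by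
    rw [NormedSpace.isVonNBounded_iff]
    exact (IsometryEquiv.addLeft y).isometry.antilipschitz.isBounded_preimage hb
  have hfr : ∀ z, gauge K₀ z = 1 ↔ y + z ∈ frontier K := by
    intro z
    rw [gauge_eq_one_iff_mem_frontier hK₀c hK₀n, hK₀, ← Homeomorph.preimage_frontier]
    rfl
  have hpos : ∀ z, z ≠ 0 → 0 < gauge K₀ z := fun z hz =>
    (gauge_pos (absorbent_nhds_zero hK₀n) hK₀b).2 hz
  have hα := hpos u hu0
  have hβ := hpos (-u) (neg_ne_zero.2 hu0)
  have hset : frontier K ∩ {x : Plane | inner ℝ x (dir θ) = inner ℝ y (dir θ)} =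
      {y + (gauge K₀ u)⁻¹ • u, y + (gauge K₀ (-u))⁻¹ • (-u)} := by
    ext x
    constructor
    · rintro ⟨hx, hxt⟩
      have hxt' : inner ℝ (x - y) (dir θ) = 0 := by
        rw [inner_sub_left]
        exact sub_eq_zero.2 hxt
      obtain ⟨s, hs⟩ := exists_eq_smul_of_inner_eq_zero hθ0 hu0 hxt' huθ
      have hxs : x = y + s • u := by rw [← hs]; abel
      have hg : gauge K₀ (s • u) = 1 := by rw [hfr, ← hxs]; exact hx
      rcases lt_trichotomy s 0 with h | h | h
      · right
        rw [show s • u = (-s) • (-u) by simp, gauge_smul_of_nonneg (by linarith)] at hg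
        rw [Set.mem_singleton_iff, hxs, ← eq_inv_of_mul_eq_one_left hg]
        simp
      · rw [h, zero_smul, gauge_zero] at hg
        exact absurd hg zero_ne_one
      · left
        rw [gauge_smul_of_nonneg h.le] at hg
        rw [hxs, ← eq_inv_of_mul_eq_one_left hg]
    · rintro (rfl | rfl)
      · refine ⟨(hfr _).1 ?_, ?_⟩
        · rw [gauge_smul_of_nonneg (inv_nonneg.2 hα.le), smul_eq_mul, inv_mul_cancel₀ hα.ne']
        · simp [inner_add_left, inner_smul_left, huθ]
      · refine ⟨(hfr _).1 ?_, ?_⟩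
        · rw [gauge_smul_of_nonneg (inv_nonneg.2 hβ.le), smul_eq_mul, inv_mul_cancel₀ hβ.ne']
        · simp [inner_add_left, inner_smul_left, huθ]
  have hne : y + (gauge K₀ u)⁻¹ • u ≠ y + (gauge K₀ (-u))⁻¹ • (-u) := by
    intro h
    have h2 : ((gauge K₀ u)⁻¹ + (gauge K₀ (-u))⁻¹) • u = 0 := by
      rw [add_smul, add_left_cancel h]
      simp
    rcases smul_eq_zero.1 h2 with h3 | h3
    · have := inv_pos.2 hα
      have := inv_pos.2 hβ
      linarith
    · exact hu0 h3
  rw [hset, Measure.count_apply ((Set.toFinite _).measurableSet), Set.encard_pair hne]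
  rfl

/-- A boundary point of a polygon with interior points is a vertex or lies on the line through two
vertices. -/
lemma frontier_convexHull_subset (F : Finset Plane)
    (hint : (interior (convexHull ℝ (F : Set Plane))).Nonempty) {x : Plane}
    (hx : x ∈ frontier (convexHull ℝ (F : Set Plane))) :
    x ∈ F ∨ ∃ p ∈ F, ∃ q ∈ F, q ≠ p ∧ ∃ s : ℝ, x = p + s • (q - p) := by
  set K := convexHull ℝ (F : Set Plane) with hKdef
  have hK : Convex ℝ K := convex_convexHull ℝ _
  have hxK : x ∈ K := F.finite_toSet.isClosed_convexHull ℝ |>.frontier_subset hx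
  -- A supporting line at `x`.
  obtain ⟨f, hf⟩ := geometric_hahn_banach_open_point hK.interior isOpen_interior hx.2
  set e := (InnerProductSpace.toDual ℝ Plane).symm f with he
  have hfe : ∀ z, f z = inner ℝ z e := by
    intro z
    rw [real_inner_comm, he, InnerProductSpace.toDual_symm_apply]
  have he0 : e ≠ 0 := by
    obtain ⟨z, hz⟩ := hint
    intro h
    have := hf z hz
    simp [hfe, h] at this
  have hle : ∀ z ∈ K, inner ℝ z e ≤ inner ℝ x e := by
    intro z hz
    have hz' : z ∈ closure (interior K) := by
      rw [hK.closure_interior_eq_closure_of_nonempty_interior hint]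
      exact subset_closure hz
    have hcl : closure (interior K) ⊆ {z | inner ℝ z e ≤ inner ℝ x e} :=
      closure_minimal (fun w hw => by simpa [hfe] using (hf w hw).le)
        (isClosed_le (by fun_prop) continuous_const)
    exact hcl hz'
  obtain ⟨w, hw0, hw1, hwx⟩ := Finset.mem_convexHull'.1 hxK
  -- Points of positive weight lie on the supporting line.
  have hface : ∀ p ∈ F, 0 < w p → inner ℝ p e = inner ℝ x e := by
    have hsum : ∑ p ∈ F, w p * (inner ℝ x e - inner ℝ p e) = 0 := by
      have h1 : inner ℝ x e = ∑ p ∈ F, w p * inner ℝ p e := by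
        conv_lhs => rw [← hwx]
        simp [sum_inner, inner_smul_left]
      simp_rw [mul_sub]
      rw [Finset.sum_sub_distrib, ← h1, ← Finset.sum_mul, hw1]
      ring
    intro p hp hwp
    have := (Finset.sum_eq_zero_iff_of_nonneg fun q hq => mul_nonneg (hw0 q hq)
      (sub_nonneg.2 (hle q (subset_convexHull ℝ _ hq)))).1 hsum p hp
    rcases mul_eq_zero.1 this with h | h
    · exact absurd h hwp.ne'
    · linarith
  obtain ⟨p, hp, hwp⟩ : ∃ p ∈ F, 0 < w p := by
    by_contra! h
    have := Finset.sum_nonpos h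
    linarith
  by_cases hex : ∃ q ∈ F, q ≠ p ∧ 0 < w q
  · obtain ⟨q, hq, hqp, hwq⟩ := hex
    right
    refine ⟨p, hp, q, hq, hqp, ?_⟩
    obtain ⟨s, hs⟩ := exists_eq_smul_of_inner_eq_zero (z := x - p) (w := q - p) he0
      (sub_ne_zero.2 hqp) (by rw [inner_sub_left, hface p hp hwp, sub_self])
      (by rw [inner_sub_left, hface p hp hwp, hface q hq hwq, sub_self])
    exact ⟨s, by rw [← hs]; abel⟩
  · left
    push Not at hex
    have hz : ∀ q ∈ F, q ≠ p → w q = 0 := fun q hq hqp =>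
      le_antisymm (hex q hq hqp) (hw0 q hq)
    have hwp1 : w p = 1 := by
      rw [← hw1, Finset.sum_eq_single_of_mem p hp hz]
    rw [Finset.sum_eq_single_of_mem p hp fun q hq hqp => by rw [hz q hq hqp, zero_smul], hwp1,
      one_smul] at hwx
    rwa [← hwx]

/-- The boundary of a polygon is covered by finitely many lines. -/
lemma exists_lines_cover (F : Finset Plane)
    (hint : (interior (convexHull ℝ (F : Set Plane))).Nonempty) :
    ∃ (m : ℕ) (a v : Fin m → Plane), (∀ j, ‖v j‖ = 1) ∧
      frontier (convexHull ℝ (F : Set Plane)) ⊆ ⋃ j, line (a j) (v j) := by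
  classical
  -- A pair of equal vertices gets an arbitrary line through the vertex.
  let V : Plane × Plane → Plane := fun r =>
    if r.2 = r.1 then dir 0 else ‖r.2 - r.1‖⁻¹ • (r.2 - r.1)
  have hV : ∀ r, ‖V r‖ = 1 := by
    intro r
    by_cases h : r.2 = r.1
    · simp only [V, if_pos h, norm_dir]
    · simp only [V, if_neg h]
      exact norm_smul_inv_norm (𝕜 := ℝ) (sub_ne_zero.2 h)
  let σ := (F ×ˢ F).equivFin
  refine ⟨_, fun j => (σ.symm j : Plane × Plane).1, fun j => V (σ.symm j), fun j => hV _, ?_⟩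
  intro x hx
  have key : ∃ r ∈ F ×ˢ F, x ∈ line r.1 (V r) := by
    rcases frontier_convexHull_subset F hint hx with h | ⟨p, hp, q, hq, hqp, s, rfl⟩
    · exact ⟨(x, x), Finset.mk_mem_product h h, 0, by simp⟩
    · refine ⟨(p, q), Finset.mk_mem_product hp hq, s * ‖q - p‖, ?_⟩
      have : ‖q - p‖ ≠ 0 := norm_ne_zero_iff.2 (sub_ne_zero.2 hqp)
      simp only [V, if_neg hqp, smul_smul]
      rw [mul_assoc, mul_inv_cancel₀ this, mul_one]
  obtain ⟨r, hr, hxr⟩ := key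
  exact Set.mem_iUnion.2 ⟨σ ⟨r, hr⟩, by simpa using hxr⟩

/-- The support function of the points `p 0, …, p n`. -/
noncomputable def supp (p : ℕ → Plane) (n : ℕ) (e : Plane) : ℝ :=
  (Finset.range (n + 1)).sup' Finset.nonempty_range_add_one fun k => inner ℝ (p k) e

/-- The width of the points `p 0, …, p n` in the direction with polar angle `θ`. -/
noncomputable def width (p : ℕ → Plane) (n : ℕ) (θ : ℝ) : ℝ :=
  supp p n (dir θ) + supp p n (-dir θ)

lemma inner_le_supp (p : ℕ → Plane) {n k : ℕ} (hk : k ≤ n) (e : Plane) :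
    inner ℝ (p k) e ≤ supp p n e :=
  Finset.le_sup' (fun k => inner ℝ (p k) e) (Finset.mem_range.2 (Nat.lt_succ_of_le hk))

lemma exists_supp_eq (p : ℕ → Plane) (n : ℕ) (e : Plane) :
    ∃ k ≤ n, supp p n e = inner ℝ (p k) e := by
  obtain ⟨k, hk, h⟩ := Finset.exists_mem_eq_sup' (Finset.nonempty_range_add_one (n := n))
    fun k => inner ℝ (p k) e
  exact ⟨k, Nat.lt_succ_iff.1 (Finset.mem_range.1 hk), h⟩

lemma width_nonneg (p : ℕ → Plane) (n : ℕ) (θ : ℝ) : 0 ≤ width p n θ := by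
  have h1 := inner_le_supp p (Nat.zero_le n) (dir θ)
  have h2 := inner_le_supp p (Nat.zero_le n) (-dir θ)
  rw [inner_neg_right] at h2
  unfold width
  linarith

lemma continuous_supp (p : ℕ → Plane) (n : ℕ) : Continuous (supp p n) := by
  unfold supp
  exact Continuous.finset_sup'_apply _ fun k _ => by fun_prop

lemma continuous_width (p : ℕ → Plane) (n : ℕ) : Continuous (width p n) :=
  ((continuous_supp p n).comp continuous_dir).add
    ((continuous_supp p n).comp continuous_dir.neg)

lemma image_inner_convexHull (p : ℕ → Plane) (n : ℕ) (e : Plane) :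
    (fun x : Plane => inner ℝ x e) '' convexHull ℝ (p '' Set.Iic n) =
      Set.Icc (-supp p n (-e)) (supp p n e) := by
  have hlin : IsLinearMap ℝ fun x : Plane => inner ℝ x e :=
    ⟨fun x y => inner_add_left x y e, fun c x => real_inner_smul_left x e c⟩
  rw [hlin.image_convexHull, Set.image_image]
  apply Set.Subset.antisymm
  · refine convexHull_min ?_ (convex_Icc _ _)
    rintro _ ⟨k, hk, rfl⟩
    refine ⟨?_, inner_le_supp p hk e⟩
    have := inner_le_supp p hk (-e)
    rw [inner_neg_right] at this
    exact neg_le.1 this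
  · obtain ⟨i, hi, hsi⟩ := exists_supp_eq p n e
    obtain ⟨j, hj, hsj⟩ := exists_supp_eq p n (-e)
    rw [inner_neg_right] at hsj
    rw [hsi, hsj, neg_neg]
    have hmem : ∀ k ≤ n, inner ℝ (p k) e ∈
        convexHull ℝ ((fun k => inner ℝ (p k) e) '' Set.Iic n) := fun k hk =>
      subset_convexHull ℝ _ ⟨k, hk, rfl⟩
    exact (convex_convexHull ℝ _).ordConnected.out (hmem j hj) (hmem i hi)

/-- For a polygon `K` with interior points, almost every line orthogonal to `dir θ` meets the
boundary in two points or not at all, according to whether it meets `K`. -/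
lemma lintegral_count_frontier (p : ℕ → Plane) (n : ℕ)
    (hint : (interior (convexHull ℝ (p '' Set.Iic n))).Nonempty) (θ : ℝ) :
    ∫⁻ t : ℝ, Measure.count (frontier (convexHull ℝ (p '' Set.Iic n)) ∩
      {x : Plane | inner ℝ x (dir θ) = t}) = 2 * ENNReal.ofReal (width p n θ) := by
  set K := convexHull ℝ (p '' Set.Iic n) with hKdef
  have hfin : (p '' Set.Iic n).Finite := (Set.finite_Iic n).image p
  have hK : Convex ℝ K := convex_convexHull ℝ _
  have hKc : IsCompact K := hfin.isCompact_convexHull ℝ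
  set lo := -supp p n (-dir θ) with hlo
  set hi := supp p n (dir θ) with hhi
  have himg := image_inner_convexHull p n (dir θ)
  rw [← hKdef, ← hlo, ← hhi] at himg
  -- The interior is dense in `K`, so its connected projection contains `(lo, hi)`.
  have hI : ∀ t ∈ Set.Ioo lo hi, ∃ y ∈ interior K, inner ℝ y (dir θ) = t := by
    intro t ht
    have hcl : ∀ z ∈ K, z ∈ closure (interior K) := fun z hz => by
      rw [hK.closure_interior_eq_closure_of_nonempty_interior hint]
      exact subset_closure hz
    obtain ⟨x, hx, hxt⟩ : ∃ x ∈ interior K, inner ℝ x (dir θ) < t := by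
      obtain ⟨z, hz, hzlo⟩ : lo ∈ (fun x : Plane => inner ℝ x (dir θ)) '' K := by
        rw [himg]
        exact Set.left_mem_Icc.2 (ht.1.trans ht.2).le
      have hopen : IsOpen {x : Plane | inner ℝ x (dir θ) < t} :=
        isOpen_lt (by fun_prop) continuous_const
      have hzt : z ∈ {x : Plane | inner ℝ x (dir θ) < t} := by
        simp only [Set.mem_ofPred_eq]
        simp only at hzlo
        rw [hzlo]
        exact ht.1
      obtain ⟨x, hx1, hx2⟩ := mem_closure_iff.1 (hcl z hz) _ hopen hzt
      exact ⟨x, hx2, hx1⟩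
    obtain ⟨x', hx', hxt'⟩ : ∃ x ∈ interior K, t < inner ℝ x (dir θ) := by
      obtain ⟨z, hz, hzhi⟩ : hi ∈ (fun x : Plane => inner ℝ x (dir θ)) '' K := by
        rw [himg]
        exact Set.right_mem_Icc.2 (ht.1.trans ht.2).le
      have hopen : IsOpen {x : Plane | t < inner ℝ x (dir θ)} :=
        isOpen_lt continuous_const (by fun_prop)
      have hzt : z ∈ {x : Plane | t < inner ℝ x (dir θ)} := by
        simp only [Set.mem_ofPred_eq]
        simp only at hzhi
        rw [hzhi]
        exact ht.2
      obtain ⟨x, hx1, hx2⟩ := mem_closure_iff.1 (hcl z hz) _ hopen hzt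
      exact ⟨x, hx2, hx1⟩
    exact hK.interior.isPreconnected.intermediate_value hx hx'
      (f := fun x : Plane => inner ℝ x (dir θ)) (by fun_prop) ⟨hxt.le, hxt'.le⟩
  have hae : ∀ᵐ t : ℝ, Measure.count (frontier K ∩ {x : Plane | inner ℝ x (dir θ) = t}) =
      (Set.Ioo lo hi).indicator (fun _ => 2) t := by
    have h1 : ∀ᵐ t : ℝ, t ≠ lo := Measure.ae_ne volume lo
    have h2 : ∀ᵐ t : ℝ, t ≠ hi := Measure.ae_ne volume hi
    filter_upwards [h1, h2] with t ht1 ht2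
    by_cases ht : t ∈ Set.Ioo lo hi
    · rw [Set.indicator_of_mem ht]
      obtain ⟨y, hy, rfl⟩ := hI t ht
      exact count_frontier_inter_fiber hK hKc.isBounded hy θ
    · rw [Set.indicator_of_notMem ht]
      have hempty : frontier K ∩ {x : Plane | inner ℝ x (dir θ) = t} = ∅ := by
        by_contra hne
        obtain ⟨x, hx, hxt⟩ := Set.nonempty_iff_ne_empty.2 hne
        have : t ∈ Set.Icc lo hi := by
          rw [← himg]
          exact ⟨x, hKc.isClosed.frontier_subset hx, hxt⟩
        exact ht ⟨lt_of_le_of_ne this.1 ht1.symm, lt_of_le_of_ne this.2 ht2⟩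
      rw [hempty, measure_empty]
  rw [lintegral_congr_ae hae, lintegral_indicator_const measurableSet_Ioo, Real.volume_Ioo]
  congr 2
  rw [hlo, hhi, width]
  ring

lemma lintegral_width (p : ℕ → Plane) (n : ℕ) :
    ∫⁻ θ in Set.Ioc (0 : ℝ) Real.pi, ENNReal.ofReal (width p n θ) =
      ENNReal.ofReal (∫ θ in (0 : ℝ)..Real.pi, width p n θ) := by
  rw [intervalIntegral.integral_of_le Real.pi_pos.le,
    ofReal_integral_eq_lintegral_ofReal (continuous_width p n).integrableOn_Ioc
      (Eventually.of_forall fun θ => width_nonneg p n θ)]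

/-- A set of points of the plane whose convex hull has no interior point lies on a line. -/
lemma subset_line_of_interior_eq_empty {F : Set Plane}
    (hint : ¬ (interior (convexHull ℝ F)).Nonempty) :
    ∃ a v : Plane, ‖v‖ = 1 ∧ convexHull ℝ F ⊆ line a v := by
  have hcol : Collinear ℝ F := by
    rw [collinear_iff_finrank_le_one]
    by_contra! h
    apply hint
    rw [interior_convexHull_nonempty_iff_affineSpan_eq_top]
    rw [AffineSubspace.affineSpan_eq_top_iff_vectorSpan_eq_top_of_nontrivial]
    refine Submodule.eq_top_of_finrank_eq (le_antisymm (Submodule.finrank_le _) ?_)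
    rw [finrank_euclideanSpace_fin]
    exact h
  obtain ⟨a, v, hav⟩ := (collinear_iff_exists_forall_eq_smul_vadd F).1 hcol
  have key : ∃ w : Plane, ‖w‖ = 1 ∧ F ⊆ line a w := by
    by_cases hv : v = 0
    · refine ⟨dir 0, norm_dir 0, fun x hx => ⟨0, ?_⟩⟩
      obtain ⟨r, hr⟩ := hav x hx
      simp [hr, hv]
    · refine ⟨‖v‖⁻¹ • v, norm_smul_inv_norm (𝕜 := ℝ) hv, fun x hx => ?_⟩
      obtain ⟨r, hr⟩ := hav x hx
      refine ⟨r * ‖v‖, ?_⟩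
      have : ‖v‖ ≠ 0 := norm_ne_zero_iff.2 hv
      simp only [smul_smul]
      rw [mul_assoc, mul_inv_cancel₀ this, mul_one, hr, vadd_eq_add, add_comm]
  obtain ⟨w, hw, hF⟩ := key
  refine ⟨a, w, hw, convexHull_min hF ?_⟩
  rintro _ ⟨s, rfl⟩ _ ⟨t, rfl⟩ α β _ _ hαβ
  refine ⟨α * s + β * t, ?_⟩
  simp only [smul_add, add_smul, smul_smul]
  nth_rewrite 1 [← one_smul ℝ a]
  rw [← hαβ, add_smul]
  abel

/-- Cauchy's formula: the perimeter length of the convex hull of finitely many points is the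
integral of its width over all directions. -/
theorem perimeter_convexHull (p : ℕ → Plane) (n : ℕ) :
    perimeter (convexHull ℝ (p '' Set.Iic n)) = ∫ θ in (0 : ℝ)..Real.pi, width p n θ := by
  have hnn : 0 ≤ ∫ θ in (0 : ℝ)..Real.pi, width p n θ :=
    intervalIntegral.integral_nonneg Real.pi_pos.le fun θ _ => width_nonneg p n θ
  have hfin : (p '' Set.Iic n).Finite := (Set.finite_Iic n).image p
  unfold perimeter
  split_ifs with hint
  · have hint' := hint
    rw [← hfin.coe_toFinset] at hint'
    obtain ⟨m, a, v, hv, hcov⟩ := exists_lines_cover _ hint'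
    rw [hfin.coe_toFinset] at hcov
    have h := crofton hv isClosed_frontier.measurableSet hcov
    simp_rw [lintegral_count_frontier p n hint] at h
    rw [lintegral_const_mul _ (continuous_width p n).measurable.ennreal_ofReal,
      lintegral_width] at h
    have h2 := (ENNReal.mul_right_inj (by norm_num) (by norm_num)).1 h
    rw [h2, ENNReal.toReal_ofReal hnn]
  · obtain ⟨a, v, hv, hl⟩ := subset_line_of_interior_eq_empty hint
    have h := two_mul_hausdorffMeasure_of_subset_line hv hl
    have hvol : ∀ θ, volume ((fun x : Plane => inner ℝ x (dir θ)) ''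
        convexHull ℝ (p '' Set.Iic n)) = ENNReal.ofReal (width p n θ) := by
      intro θ
      rw [image_inner_convexHull, Real.volume_Icc, sub_neg_eq_add, width]
    simp_rw [hvol] at h
    rw [lintegral_width] at h
    have h2 := congrArg ENNReal.toReal h
    rwa [ENNReal.toReal_mul, ENNReal.toReal_ofReal hnn] at h2

/-! ### Rotating the steps of a walk -/

/-- The partial sums of a sequence of steps. -/
noncomputable def path (x : ℕ → Plane) (n : ℕ) : Plane := ∑ k ∈ Finset.range n, x k

/-- The integrated width, that is, the perimeter of the convex hull, of the first `n + 1` positions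
of the path with steps `x`. -/
noncomputable def len (x : ℕ → Plane) (n : ℕ) : ℝ :=
  ∫ θ in (0 : ℝ)..Real.pi, width (path x) n θ

lemma path_add (x : ℕ → Plane) (j k : ℕ) :
    path x (j + k) = path x j + path (fun i => x (j + i)) k := by
  simp [path, Finset.sum_range_add]

lemma supp_zero (p : ℕ → Plane) (e : Plane) : supp p 0 e = inner ℝ (p 0) e := by
  simp [supp]

lemma supp_succ (p : ℕ → Plane) (n : ℕ) (e : Plane) :
    supp p (n + 1) e = max (supp p n e) (inner ℝ (p (n + 1)) e) := by
  apply le_antisymm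
  · obtain ⟨k, hk, h⟩ := exists_supp_eq p (n + 1) e
    rw [h]
    rcases Nat.le_succ_iff.1 hk with hk' | rfl
    · exact (inner_le_supp p hk' e).trans (le_max_left _ _)
    · exact le_max_right _ _
  · refine max_le ?_ (inner_le_supp p le_rfl e)
    obtain ⟨k, hk, h⟩ := exists_supp_eq p n e
    rw [h]
    exact inner_le_supp p (Nat.le_succ_of_le hk) e

lemma supp_succ' (p : ℕ → Plane) (n : ℕ) (e : Plane) :
    supp p (n + 1) e = max (inner ℝ (p 0) e) (supp (fun k => p (k + 1)) n e) := by
  induction n with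
  | zero => simp only [supp_succ, supp_zero]
  | succ n ih => rw [supp_succ, ih, supp_succ (fun k => p (k + 1)), max_assoc]

lemma supp_const_add (c : Plane) (p : ℕ → Plane) (n : ℕ) (e : Plane) :
    supp (fun k => c + p k) n e = inner ℝ c e + supp p n e := by
  induction n with
  | zero => simp only [supp_zero, inner_add_left]
  | succ n ih => rw [supp_succ, supp_succ, ih, inner_add_left, max_add_add_left]

lemma supp_path_add (x : ℕ → Plane) (j n : ℕ) (e : Plane) :
    supp (fun k => path x (j + k)) n e =
      inner ℝ (path x j) e + supp (path fun i => x (j + i)) n e := by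
  rw [← supp_const_add]
  simp_rw [path_add]

/-- For steps of period `n + 1`, the last increments of the support function over all `n + 1`
rotations of one period add up to the positive part of the total displacement: either every
increment vanishes, or they are the differences of the maxima over successive windows of the
walk, and the sum telescopes. -/
lemma sum_rotations_supp (x : ℕ → Plane) (n : ℕ) (hx : ∀ i, x (i + (n + 1)) = x i) (e : Plane) :
    ∑ j ∈ Finset.range (n + 1), (supp (path fun i => x (j + i)) (n + 1) e -
      supp (path fun i => x (j + i)) n e) = max 0 (inner ℝ (path x (n + 1)) e) := by
  have hper : ∀ j, path x (j + (n + 1)) = path x j + path x (n + 1) := by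
    intro j
    rw [add_comm j, path_add, add_comm]
    congr 2
    funext i
    rw [add_comm, hx]
  set s := inner ℝ (path x (n + 1)) e with hs
  have hinc : ∀ j, supp (path fun i => x (j + i)) (n + 1) e -
      supp (path fun i => x (j + i)) n e =
      supp (fun k => path x (j + k)) (n + 1) e - supp (fun k => path x (j + k)) n e := by
    intro j
    rw [supp_path_add, supp_path_add]
    ring
  simp_rw [hinc]
  -- For `s ≤ 0` the last point of each window lies below its first point, so no maximum increases;
  -- for `s ≥ 0` it lies above, so the first point can be dropped from the window.
  rcases le_total s 0 with h | h
  · rw [max_eq_left h]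
    refine Finset.sum_eq_zero fun j _ => ?_
    rw [supp_succ, max_eq_left, sub_self]
    refine le_trans ?_ (inner_le_supp _ (Nat.zero_le n) e)
    rw [hper, inner_add_left, ← hs]
    simpa using h
  · rw [max_eq_right h]
    have hwin : ∀ j, supp (fun k => path x (j + k)) (n + 1) e =
        supp (fun k => path x (j + 1 + k)) n e := by
      intro j
      rw [supp_succ', max_eq_right]
      · congr 1
        funext k
        congr 1
        ring
      · refine le_trans ?_ (inner_le_supp _ le_rfl e)
        simp only [add_zero]
        rw [hper, inner_add_left, ← hs]
        linarith
    simp_rw [hwin]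
    rw [Finset.sum_range_sub fun j => supp (fun k => path x (j + k)) n e]
    have hlast : supp (fun k => path x (n + 1 + k)) n e =
        supp (fun k => path x (0 + k)) n e + s := by
      rw [hs, add_comm _ (inner ℝ _ _), ← supp_const_add]
      congr 1
      funext k
      rw [zero_add, add_comm (n + 1), hper, add_comm]
    rw [hlast]
    ring

/-- For steps of period `n + 1`, the last increments of the perimeter over all rotations of one
period add up to twice the length of the total displacement. -/
theorem sum_rotations_len (x : ℕ → Plane) (n : ℕ) (hx : ∀ i, x (i + (n + 1)) = x i) :
    ∑ j ∈ Finset.range (n + 1), (len (fun i => x (j + i)) (n + 1) - len (fun i => x (j + i)) n) =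
      2 * ‖path x (n + 1)‖ := by
  have hint : ∀ (y : ℕ → Plane) (m : ℕ),
      IntervalIntegrable (width (path y) m) volume 0 Real.pi := fun y m =>
    (continuous_width _ _).intervalIntegrable _ _
  simp_rw [len, ← intervalIntegral.integral_sub (hint _ _) (hint _ _)]
  rw [← intervalIntegral.integral_finsetSum fun j _ => (hint _ _).sub (hint _ _),
    ← integral_abs_inner_dir]
  refine intervalIntegral.integral_congr fun θ _ => ?_
  have h1 := sum_rotations_supp x n hx (dir θ)
  have h2 := sum_rotations_supp x n hx (-dir θ)
  rw [inner_neg_right] at h2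
  calc _ = max 0 (inner ℝ (path x (n + 1)) (dir θ)) +
        max 0 (-inner ℝ (path x (n + 1)) (dir θ)) := by
        rw [← h1, ← h2, ← Finset.sum_add_distrib]
        refine Finset.sum_congr rfl fun j _ => ?_
        simp only [width]
        ring
    _ = _ := by
        rcases le_total 0 (inner ℝ (path x (n + 1)) (dir θ)) with h | h
        · rw [max_eq_right h, max_eq_left (by linarith), abs_of_nonneg h, add_zero]
        · rw [max_eq_left h, max_eq_right (by linarith), abs_of_nonpos h, zero_add]

/-! ### The expected perimeter -/

lemma path_congr {x y : ℕ → Plane} {n : ℕ} (h : ∀ i < n, x i = y i) : path x n = path y n :=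
  Finset.sum_congr rfl fun i hi => h i (Finset.mem_range.1 hi)

lemma len_congr {x y : ℕ → Plane} {n : ℕ} (h : ∀ i < n, x i = y i) : len x n = len y n := by
  have hs : ∀ e, supp (path x) n e = supp (path y) n e := fun e =>
    Finset.sup'_congr _ rfl fun k hk => by
      rw [path_congr fun i hi => h i (hi.trans_le (Nat.lt_succ_iff.1 (Finset.mem_range.1 hk)))]
  simp only [len, width, hs]

lemma len_zero (x : ℕ → Plane) : len x 0 = 0 := by
  simp [len, width, supp_zero, path]

lemma len_nonneg (x : ℕ → Plane) (n : ℕ) : 0 ≤ len x n :=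
  intervalIntegral.integral_nonneg Real.pi_pos.le fun _ _ => width_nonneg _ _ _

lemma len_le (x : ℕ → Plane) (n : ℕ) :
    len x n ≤ 2 * Real.pi * ∑ i ∈ Finset.range n, ‖x i‖ := by
  have hs : ∀ e : Plane, ‖e‖ = 1 → supp (path x) n e ≤ ∑ i ∈ Finset.range n, ‖x i‖ := by
    intro e he
    obtain ⟨k, hk, h⟩ := exists_supp_eq (path x) n e
    rw [h]
    calc inner ℝ (path x k) e ≤ ‖path x k‖ * ‖e‖ := real_inner_le_norm _ _
      _ ≤ ∑ i ∈ Finset.range k, ‖x i‖ := by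
        rw [he, mul_one]
        exact norm_sum_le _ _
      _ ≤ _ := Finset.sum_le_sum_of_subset_of_nonneg (Finset.range_mono hk)
        fun _ _ _ => norm_nonneg _
  calc len x n ≤ ∫ _ in (0 : ℝ)..Real.pi, 2 * ∑ i ∈ Finset.range n, ‖x i‖ := by
        refine intervalIntegral.integral_mono_on Real.pi_pos.le
          ((continuous_width _ _).intervalIntegrable _ _) intervalIntegrable_const fun θ _ => ?_
        have h1 := hs (dir θ) (norm_dir θ)
        have h2 := hs (-dir θ) (by rw [norm_neg, norm_dir])
        rw [width]
        linarith
    _ = _ := by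
        rw [intervalIntegral.integral_const, smul_eq_mul]
        ring

lemma measurable_len (n : ℕ) : Measurable fun x : ℕ → Plane => len x n := by
  have hpath : ∀ k, Measurable fun x : ℕ → Plane => path x k := fun k =>
    Finset.measurable_fun_sum _ fun i _ => measurable_pi_apply i
  have hsupp : ∀ g : ℝ → Plane, Measurable g →
      Measurable fun q : (ℕ → Plane) × ℝ => supp (path q.1) n (g q.2) := by
    intro g hg
    induction n with
    | zero =>
      simp_rw [supp_zero]
      exact ((hpath 0).comp measurable_fst).inner (hg.comp measurable_snd)
    | succ n ih =>
      simp_rw [supp_succ]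
      exact ih.max (((hpath (n + 1)).comp measurable_fst).inner (hg.comp measurable_snd))
  have hw : Measurable fun q : (ℕ → Plane) × ℝ => width (path q.1) n q.2 :=
    (hsupp dir continuous_dir.measurable).add
      (hsupp (fun θ => -dir θ) continuous_dir.neg.measurable)
  simp_rw [len, intervalIntegral.integral_of_le Real.pi_pos.le]
  exact (hw.stronglyMeasurable.integral_prod_right).measurable

lemma perimeterLength_eq_len {Ω : Type*} (Z : ℕ → Ω → Plane) (n : ℕ) (ω : Ω) :
    perimeterLength Z n ω = len (fun k => Z k ω) n :=
  perimeter_convexHull _ n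

section Walk

variable {Ω : Type*} [MeasurableSpace Ω] {P : Measure Ω}
  {Z : ℕ → Ω → Plane}

lemma integrable_len (hZ : ∀ k, Measurable (Z k)) (hint : ∀ k, Integrable (Z k) P) (σ : ℕ → ℕ)
    (n : ℕ) : Integrable (fun ω => len (fun i => Z (σ i) ω) n) P := by
  refine Integrable.mono'
    (g := fun ω => 2 * Real.pi * ∑ i ∈ Finset.range n, ‖Z (σ i) ω‖) ?_ ?_ ?_
  · exact (integrable_finsetSum _ fun i _ => (hint (σ i)).norm).const_mul _
  · exact ((measurable_len n).comp (measurable_pi_lambda _ fun i => hZ (σ i))).aestronglyMeasurable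
  · refine Eventually.of_forall fun ω => ?_
    rw [Real.norm_of_nonneg (len_nonneg _ _)]
    exact len_le _ _

variable [IsProbabilityMeasure P]

/-- The law of an i.i.d. sequence is invariant under injective selections of the indices. -/
lemma integral_len_comp_injective (hZ : ∀ k, Measurable (Z k)) (hindep : iIndepFun Z P)
    (hid : ∀ k, P.map (Z k) = P.map (Z 0)) {σ : ℕ → ℕ} (hσ : σ.Injective) (n : ℕ) :
    ∫ ω, len (fun i => Z (σ i) ω) n ∂P = ∫ ω, len (fun i => Z i ω) n ∂P := by
  have h1 := (iIndepFun_iff_map_fun_eq_infinitePi_map (fun i => hZ (σ i))).1 (hindep.precomp hσ)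
  have h2 := (iIndepFun_iff_map_fun_eq_infinitePi_map hZ).1 hindep
  have h12 : P.map (fun ω i => Z (σ i) ω) = P.map (fun ω i => Z i ω) := by
    rw [h1, h2]
    simp_rw [hid (σ _), hid]
  rw [← integral_map (φ := fun ω i => Z (σ i) ω) (f := fun x => len x n)
      (measurable_pi_lambda _ fun i => hZ (σ i)).aemeasurable
      (measurable_len n).aestronglyMeasurable, h12,
    integral_map (measurable_pi_lambda _ hZ).aemeasurable
      (measurable_len n).aestronglyMeasurable]

/-- Rotation of the indices `0, …, n` by `j`; the other indices are fixed. -/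
def rotate (n j i : ℕ) : ℕ := if i < n + 1 then (j + i) % (n + 1) else i

lemma rotate_injective (n j : ℕ) : (rotate n j).Injective := by
  have hlt : ∀ a, (j + a) % (n + 1) < n + 1 := fun a => Nat.mod_lt _ n.succ_pos
  intro a b h
  unfold rotate at h
  split_ifs at h with ha hb hb
  · have : a ≡ b [MOD n + 1] := Nat.ModEq.add_left_cancel' j h
    exact Nat.ModEq.eq_of_lt_of_lt this ha hb
  · have := hlt a
    omega
  · have := hlt b
    omega
  · exact h

/-- The mean increment of the perimeter: averaging over the rotations of the first `n + 1` steps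
does not change the expectation. -/
lemma integral_len_succ (hZ : ∀ k, Measurable (Z k)) (hint : ∀ k, Integrable (Z k) P)
    (hindep : iIndepFun Z P) (hid : ∀ k, P.map (Z k) = P.map (Z 0)) (n : ℕ) :
    ∫ ω, len (fun i => Z i ω) (n + 1) ∂P = ∫ ω, len (fun i => Z i ω) n ∂P +
      2 * (∫ ω, ‖walk Z (n + 1) ω‖ ∂P) / (n + 1 : ℝ) := by
  have hrot : ∀ j ω, ∀ m ≤ n + 1, len (fun i => Z ((j + i) % (n + 1)) ω) m =
      len (fun i => Z (rotate n j i) ω) m := by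
    intro j ω m hm
    refine len_congr fun i hi => ?_
    rw [rotate, if_pos (hi.trans_le hm)]
  have hsum : ∀ ω, ∑ j ∈ Finset.range (n + 1), (len (fun i => Z (rotate n j i) ω) (n + 1) -
      len (fun i => Z (rotate n j i) ω) n) = 2 * ‖walk Z (n + 1) ω‖ := by
    intro ω
    have h := sum_rotations_len (fun i => Z (i % (n + 1)) ω) n fun i => by
      rw [Nat.add_mod_right]
    rw [path_congr (y := fun i => Z i ω) fun i hi => by rw [Nat.mod_eq_of_lt hi]] at h
    rw [show walk Z (n + 1) ω = path (fun i => Z i ω) (n + 1) from rfl, ← h]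
    refine Finset.sum_congr rfl fun j _ => ?_
    rw [hrot j ω _ le_rfl, hrot j ω n n.le_succ]
  have hI := integral_congr_ae (μ := P) (Eventually.of_forall hsum)
  rw [integral_finsetSum (f := fun j ω => len (fun i => Z (rotate n j i) ω) (n + 1) -
      len (fun i => Z (rotate n j i) ω) n) _ fun j _ =>
    (integrable_len hZ hint (rotate n j) (n + 1)).sub (integrable_len hZ hint (rotate n j) n),
    integral_const_mul] at hI
  simp_rw [integral_sub (integrable_len hZ hint (rotate n _) (n + 1))
    (integrable_len hZ hint (rotate n _) n),
    integral_len_comp_injective hZ hindep hid (rotate_injective n _)] at hI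
  rw [Finset.sum_const, Finset.card_range, nsmul_eq_mul] at hI
  rw [← hI]
  push_cast
  have : (n + 1 : ℝ) ≠ 0 := by positivity
  field_simp
  ring

/-- The Spitzer–Widom formula. -/
theorem integral_len_eq_sum (hZ : ∀ k, Measurable (Z k)) (hint : ∀ k, Integrable (Z k) P)
    (hindep : iIndepFun Z P) (hid : ∀ k, P.map (Z k) = P.map (Z 0)) (n : ℕ) :
    ∫ ω, len (fun i => Z i ω) n ∂P =
      ∑ k ∈ Finset.range n, 2 * (∫ ω, ‖walk Z (k + 1) ω‖ ∂P) / (k + 1 : ℝ) := by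
  induction n with
  | zero => simp [len_zero]
  | succ n ih => rw [integral_len_succ hZ hint hindep hid, ih, Finset.sum_range_succ]

end Walk

/-! ### Uniform integrability of normalized squared sums -/

section Moments

variable {Ω : Type*} [MeasurableSpace Ω] {P : Measure Ω} [IsProbabilityMeasure P]
  {X : ℕ → Ω → ℝ}

lemma integral_sum_sq (hL : ∀ k, MemLp (X k) 2 P) (hindep : iIndepFun X P)
    (h0 : ∀ k, ∫ ω, X k ω ∂P = 0) (n : ℕ) :
    ∫ ω, (∑ k ∈ Finset.range n, X k ω) ^ 2 ∂P = ∑ k ∈ Finset.range n, ∫ ω, X k ω ^ 2 ∂P := by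
  have hvar : ∀ k, Var[X k; P] = ∫ ω, X k ω ^ 2 ∂P := fun k =>
    variance_of_integral_eq_zero (hL k).aemeasurable (h0 k)
  have hs := IndepFun.variance_sum (s := Finset.range n) (fun i _ => hL i)
    fun i _ j _ hij => hindep.indepFun hij
  rw [variance_of_integral_eq_zero] at hs
  · simpa [hvar] using hs
  · exact (memLp_finsetSum' _ fun i _ => hL i).aemeasurable
  · simp only [Finset.sum_apply]
    rw [integral_finsetSum _ fun i _ => (hL i).integrable one_le_two]
    simp [h0]

lemma integrable_of_abs_le {f : Ω → ℝ} (hf : Measurable f) {C : ℝ} (h : ∀ ω, |f ω| ≤ C) :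
    Integrable f P :=
  Integrable.of_bound hf.aestronglyMeasurable C (Eventually.of_forall h)

/-- The fourth moment of a sum of `n` centred independent variables bounded by `K`. -/
lemma integral_sum_pow_four_le (hX : ∀ k, Measurable (X k)) (hindep : iIndepFun X P)
    (h0 : ∀ k, ∫ ω, X k ω ∂P = 0) {K : ℝ} (hK : ∀ k ω, |X k ω| ≤ K) (n : ℕ) :
    ∫ ω, (∑ k ∈ Finset.range n, X k ω) ^ 4 ∂P ≤ 3 * n ^ 2 * K ^ 4 := by
  have hm : ∀ n, Measurable fun ω => ∑ k ∈ Finset.range n, X k ω := fun n =>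
    Finset.measurable_fun_sum _ fun k _ => hX k
  have hb : ∀ n ω, |∑ k ∈ Finset.range n, X k ω| ≤ n * K := fun n ω =>
    (Finset.abs_sum_le_sum_abs _ _).trans <|
      (Finset.sum_le_sum fun k _ => hK k ω).trans (by simp)
  have hint : ∀ n a b, Integrable
      (fun ω => (∑ k ∈ Finset.range n, X k ω) ^ a * X n ω ^ b) P := fun n a b =>
    integrable_of_abs_le (C := (n * K) ^ a * K ^ b) (((hm n).pow_const a).mul ((hX n).pow_const b))
      fun ω => by
        rw [abs_mul, abs_pow, abs_pow]
        have h1 := hb n ω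
        have h2 := hK n ω
        have h3 := (abs_nonneg (∑ k ∈ Finset.range n, X k ω)).trans h1
        gcongr
  have hmul : ∀ n a b, ∫ ω, (∑ k ∈ Finset.range n, X k ω) ^ a * X n ω ^ b ∂P =
      (∫ ω, (∑ k ∈ Finset.range n, X k ω) ^ a ∂P) * ∫ ω, X n ω ^ b ∂P := by
    intro n a b
    have hi := (hindep.indepFun_finsetSum_of_notMem hX (Finset.notMem_range_self (n := n))).comp
      (measurable_id.pow_const a) (measurable_id.pow_const b)
    have := hi.integral_mul_eq_mul_integral
      ((((hm n).pow_const a).aestronglyMeasurable.congr (Eventually.of_forall fun ω => by simp)))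
      ((hX n).pow_const b).aestronglyMeasurable
    simpa using this
  have hsum0 : ∀ n, ∫ ω, ∑ k ∈ Finset.range n, X k ω ∂P = 0 := by
    intro n
    rw [integral_finsetSum _ fun i _ => integrable_of_abs_le (hX i) (hK i)]
    simp [h0]
  have hsq : ∀ n, ∫ ω, X n ω ^ 2 ∂P ≤ K ^ 2 := by
    intro n
    have := integral_mono_of_nonneg (μ := P) (Eventually.of_forall fun ω => sq_nonneg (X n ω))
      (integrable_const (K ^ 2)) (Eventually.of_forall fun ω => sq_le_sq' (abs_le.1 (hK n ω)).1
        (abs_le.1 (hK n ω)).2)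
    simpa using this
  have hfour : ∀ n, ∫ ω, X n ω ^ 4 ∂P ≤ K ^ 4 := by
    intro n
    have := integral_mono_of_nonneg (μ := P) (f := fun ω => X n ω ^ 4)
      (Eventually.of_forall fun ω => by positivity)
      (integrable_const (K ^ 4)) (Eventually.of_forall fun ω => by
        have := pow_le_pow_left₀ (abs_nonneg _) (hK n ω) 4
        simpa [← abs_pow, abs_of_nonneg (show 0 ≤ X n ω ^ 4 by positivity)] using this)
    simpa using this
  have hsumsq : ∀ n : ℕ, ∫ ω, (∑ k ∈ Finset.range n, X k ω) ^ 2 ∂P ≤ n * K ^ 2 := by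
    intro n
    rw [integral_sum_sq (fun k => MemLp.of_bound (hX k).aestronglyMeasurable K
      (Eventually.of_forall (hK k))) hindep h0]
    exact (Finset.sum_le_sum fun k _ => hsq k).trans (by simp)
  induction n with
  | zero => simp
  | succ n ih =>
    have hexp : ∀ ω, (∑ k ∈ Finset.range (n + 1), X k ω) ^ 4 =
        (∑ k ∈ Finset.range n, X k ω) ^ 4 * X n ω ^ 0 +
        (4 * ((∑ k ∈ Finset.range n, X k ω) ^ 3 * X n ω ^ 1) +
        (6 * ((∑ k ∈ Finset.range n, X k ω) ^ 2 * X n ω ^ 2) +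
        (4 * ((∑ k ∈ Finset.range n, X k ω) ^ 1 * X n ω ^ 3) +
          (∑ k ∈ Finset.range n, X k ω) ^ 0 * X n ω ^ 4))) := fun ω => by
      rw [Finset.sum_range_succ]
      ring
    simp_rw [hexp]
    have i1 := (hint n 1 3).const_mul 4
    have i2 := (hint n 2 2).const_mul 6
    have i3 := (hint n 3 1).const_mul 4
    rw [integral_add (hint n 4 0) (i3.fun_add (i2.fun_add (i1.fun_add (hint n 0 4)))),
      integral_add i3 (i2.fun_add (i1.fun_add (hint n 0 4))),
      integral_add i2 (i1.fun_add (hint n 0 4)),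
      integral_add i1 (hint n 0 4), integral_const_mul, integral_const_mul, integral_const_mul,
      hmul, hmul, hmul, hmul, hmul]
    have h22 : (∫ ω, (∑ k ∈ Finset.range n, X k ω) ^ 2 ∂P) * ∫ ω, X n ω ^ 2 ∂P ≤
        n * K ^ 2 * K ^ 2 :=
      mul_le_mul (hsumsq n) (hsq n) (integral_nonneg fun ω => sq_nonneg _) (by positivity)
    have := hfour n
    simp [h0, hsum0]
    nlinarith [show 0 ≤ K ^ 4 by positivity]

/-- Uniform integrability: for a centred i.i.d. square integrable sequence, the second moments of
the normalized sums carry asymptotically no mass on events of vanishing probability. The sequence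
is split into a bounded part, controlled by fourth moments, and a part of small variance. -/
theorem tendsto_setIntegral_sum_sq (hX : ∀ k, Measurable (X k)) (hindep : iIndepFun X P)
    (hid : ∀ k, IdentDistrib (X k) (X 0) P P) (hL : MemLp (X 0) 2 P)
    (h0 : ∫ ω, X 0 ω ∂P = 0) {A : ℕ → Set Ω}
    (hPA : Tendsto (fun n => P.real (A n)) atTop (𝓝 0)) :
    Tendsto (fun n : ℕ => ∫ ω in A n, (∑ k ∈ Finset.range n, X k ω) ^ 2 / n ∂P) atTop (𝓝 0) := by
  -- Tails of the second moment are small.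
  have htail : Tendsto (fun M : ℕ => ∫ ω, (if |X 0 ω| ≤ M then 0 else X 0 ω) ^ 2 ∂P) atTop
      (𝓝 0) := by
    have hz : (0 : ℝ) = ∫ _ω, (0 : ℝ) ∂P := by simp
    rw [hz]
    refine tendsto_integral_of_dominated_convergence (fun ω => X 0 ω ^ 2) ?_ hL.integrable_sq ?_ ?_
    · intro M
      exact ((Measurable.ite (measurableSet_le (hX 0).abs measurable_const) measurable_const
        (hX 0)).pow_const 2).aestronglyMeasurable
    · intro M
      refine Eventually.of_forall fun ω => ?_
      rw [Real.norm_of_nonneg (sq_nonneg _)]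
      split_ifs
      · simpa using sq_nonneg (X 0 ω)
      · exact le_rfl
    · refine Eventually.of_forall fun ω => ?_
      obtain ⟨N, hN⟩ := exists_nat_ge |X 0 ω|
      refine tendsto_const_nhds.congr' ?_
      filter_upwards [eventually_ge_atTop N] with M hM
      rw [if_pos (hN.trans (by exact_mod_cast hM))]
      simp
  rw [Metric.tendsto_atTop]
  intro ε hε
  obtain ⟨M, hM⟩ := (htail.eventually_lt_const (show 0 < ε / 8 by positivity)).exists
  -- The truncation at level `M`, recentred.
  set τ : ℝ → ℝ := fun x => if |x| ≤ M then x else 0 with hτ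
  have hτm : Measurable τ := Measurable.ite (measurableSet_le measurable_id.abs measurable_const)
    measurable_id measurable_const
  have hτb : ∀ x, |τ x| ≤ M := by
    intro x
    simp only [hτ]
    split_ifs with h
    · exact h
    · simp
  set c := ∫ ω, τ (X 0 ω) ∂P with hc
  have hcb : |c| ≤ M := by
    have := norm_integral_le_of_norm_le_const (μ := P) (f := fun ω => τ (X 0 ω)) (C := (M : ℝ))
      (Eventually.of_forall fun ω => hτb _)
    simpa using this
  set U : ℕ → Ω → ℝ := fun k ω => τ (X k ω) - c with hU
  -- The remainder, which is centred because `X` is.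
  set W : ℕ → Ω → ℝ := fun k ω => X k ω - τ (X k ω) + c with hW
  have hτi : ∀ k, Integrable (fun ω => τ (X k ω)) P := fun k =>
    integrable_of_abs_le (hτm.comp (hX k)) fun ω => hτb _
  have hτc : ∀ k, ∫ ω, τ (X k ω) ∂P = c := fun k => ((hid k).comp hτm).integral_eq
  have hLk : ∀ k, MemLp (X k) 2 P := fun k => (hid k).memLp_iff.2 hL
  have h0k : ∀ k, ∫ ω, X k ω ∂P = 0 := fun k => (hid k).integral_eq.trans h0
  have hUm : ∀ k, Measurable (U k) := fun k => (hτm.comp (hX k)).sub_const c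
  have hUb : ∀ k ω, |U k ω| ≤ 2 * M := fun k ω => by
    have := abs_sub (τ (X k ω)) c
    have := hτb (X k ω)
    simp only [hU]
    linarith
  have hU0 : ∀ k, ∫ ω, U k ω ∂P = 0 := fun k => by
    simp only [hU]
    rw [integral_sub (hτi k) (integrable_const c), hτc]
    simp
  have hUind : iIndepFun U P := hindep.comp (fun _ x => τ x - c) fun _ => hτm.sub_const c
  have hWind : iIndepFun W P := hindep.comp (fun _ x => x - τ x + c)
    fun _ => (measurable_id.sub hτm).add_const c
  have hWid : ∀ k, IdentDistrib (W k) (W 0) P P := fun k =>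
    (hid k).comp ((measurable_id.sub hτm).add_const c)
  have hWL : ∀ k, MemLp (W k) 2 P := fun k =>
    ((hLk k).sub (MemLp.of_bound (hτm.comp (hX k)).aestronglyMeasurable M
      (Eventually.of_forall fun ω => hτb _))).add (memLp_const c)
  have hW0 : ∀ k, ∫ ω, W k ω ∂P = 0 := fun k => by
    simp only [hW]
    have hd : Integrable (fun ω => X k ω - τ (X k ω)) P :=
      ((hLk k).integrable one_le_two).sub (hτi k)
    rw [integral_add hd (integrable_const c),
      integral_sub ((hLk k).integrable one_le_two) (hτi k), hτc, h0k]
    simp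
  have hWsq : ∀ k, ∫ ω, W k ω ^ 2 ∂P = ∫ ω, W 0 ω ^ 2 ∂P := fun k => (hWid k).sq.integral_eq
  have hWε : ∫ ω, W 0 ω ^ 2 ∂P ≤ ε / 8 := by
    have hY : MemLp (fun ω => X 0 ω - τ (X 0 ω)) 2 P :=
      hL.sub (MemLp.of_bound (hτm.comp (hX 0)).aestronglyMeasurable M
        (Eventually.of_forall fun ω => hτb _))
    have hY1 : ∫ ω, (X 0 ω - τ (X 0 ω)) ∂P = -c := by
      rw [integral_sub (hL.integrable one_le_two) (hτi 0), h0, hτc]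
      ring
    have h1 : ∫ ω, W 0 ω ^ 2 ∂P = Var[fun ω => X 0 ω - τ (X 0 ω); P] := by
      rw [variance_eq_integral hY.aemeasurable, hY1]
      simp only [hW, sub_neg_eq_add]
    rw [h1]
    refine (variance_le_expectation_sq hY.aestronglyMeasurable).trans ?_
    refine (le_of_eq ?_).trans hM.le
    refine integral_congr_ae (Eventually.of_forall fun ω => ?_)
    simp only [hτ, Pi.pow_apply]
    split_ifs <;> simp
  -- Weight in `2 x ≤ η x ^ 2 + η⁻¹`, chosen so that the fourth moment term stays below `ε / 16`.
  set η : ℝ := ε / (16 * (3 * (2 * M) ^ 4 + 1)) with hη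
  have hηpos : 0 < η := by positivity
  have hηK : η * (3 * (2 * (M : ℝ)) ^ 4) ≤ ε / 16 := by
    rw [hη, div_mul_eq_mul_div, div_le_div_iff₀ (by positivity) (by norm_num)]
    nlinarith [show 0 ≤ 3 * (2 * (M : ℝ)) ^ 4 by positivity]
  obtain ⟨N, hN⟩ := eventually_atTop.1
    (hPA.eventually_lt_const (show 0 < η * (ε / 8) by positivity))
  refine ⟨max N 1, fun n hn => ?_⟩
  have hn1 : (0 : ℝ) < n := by exact_mod_cast (le_max_right N 1).trans hn
  have hPn := hN n ((le_max_left N 1).trans hn)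
  have hnn : 0 ≤ ∫ ω in A n, (∑ k ∈ Finset.range n, X k ω) ^ 2 / n ∂P :=
    integral_nonneg fun ω => by positivity
  rw [Real.dist_eq, sub_zero, abs_of_nonneg hnn]
  have hUS : Measurable fun ω => ∑ k ∈ Finset.range n, U k ω :=
    Finset.measurable_fun_sum _ fun k _ => hUm k
  have hI4 : Integrable (fun ω => (∑ k ∈ Finset.range n, U k ω) ^ 4) P :=
    integrable_of_abs_le (C := (n * (2 * M)) ^ 4) (hUS.pow_const 4) fun ω => by
      rw [abs_pow]
      have : |∑ k ∈ Finset.range n, U k ω| ≤ n * (2 * M) :=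
        (Finset.abs_sum_le_sum_abs _ _).trans <|
          (Finset.sum_le_sum fun k _ => hUb k ω).trans (by simp)
      gcongr
  have hI2 : Integrable (fun ω => (∑ k ∈ Finset.range n, W k ω) ^ 2) P := by
    have := (memLp_finsetSum (Finset.range n) fun k _ => hWL k).integrable_sq
    exact this
  have hpt : ∀ ω, (∑ k ∈ Finset.range n, X k ω) ^ 2 / n ≤
      (η / n ^ 2) * (∑ k ∈ Finset.range n, U k ω) ^ 4 + 1 / η +
        (2 / n) * (∑ k ∈ Finset.range n, W k ω) ^ 2 := by
    intro ω
    have hsplit : ∑ k ∈ Finset.range n, X k ω =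
        ∑ k ∈ Finset.range n, U k ω + ∑ k ∈ Finset.range n, W k ω := by
      rw [← Finset.sum_add_distrib]
      refine Finset.sum_congr rfl fun k _ => ?_
      simp only [hU, hW]
      ring
    set u := ∑ k ∈ Finset.range n, U k ω
    set w := ∑ k ∈ Finset.range n, W k ω
    have h1 : (u + w) ^ 2 / n ≤ 2 * (u ^ 2 / n) + 2 / n * w ^ 2 := by
      rw [show 2 * (u ^ 2 / n) + 2 / n * w ^ 2 = (2 * u ^ 2 + 2 * w ^ 2) / n by ring]
      gcongr
      nlinarith [sq_nonneg (u - w)]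
    have h2 : 2 * (u ^ 2 / n) ≤ η / n ^ 2 * u ^ 4 + 1 / η := by
      rw [show η / n ^ 2 * u ^ 4 + 1 / η = η * (u ^ 2 / n) ^ 2 + η⁻¹ by ring]
      have h3 : 0 ≤ η⁻¹ * (η * (u ^ 2 / n) - 1) ^ 2 := by positivity
      have h4 : η⁻¹ * (η * (u ^ 2 / n) - 1) ^ 2 =
          η * (u ^ 2 / n) ^ 2 + η⁻¹ - 2 * (u ^ 2 / n) := by
        field_simp
        ring
      linarith
    rw [hsplit]
    linarith
  have hIa : Integrable (fun ω => (η / n ^ 2) * (∑ k ∈ Finset.range n, U k ω) ^ 4) P :=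
    hI4.const_mul _
  have hIw : Integrable (fun ω => (2 / n) * (∑ k ∈ Finset.range n, W k ω) ^ 2) P :=
    hI2.const_mul _
  have hIX : Integrable (fun ω => (∑ k ∈ Finset.range n, X k ω) ^ 2 / n) P := by
    have := (memLp_finsetSum (Finset.range n) fun k _ => hLk k).integrable_sq
    exact this.div_const _
  calc ∫ ω in A n, (∑ k ∈ Finset.range n, X k ω) ^ 2 / n ∂P
      ≤ ∫ ω in A n, ((η / n ^ 2) * (∑ k ∈ Finset.range n, U k ω) ^ 4 + 1 / η +
        (2 / n) * (∑ k ∈ Finset.range n, W k ω) ^ 2) ∂P :=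
        setIntegral_mono hIX.integrableOn ((hIa.add (integrable_const _)).add hIw).integrableOn hpt
    _ = ∫ ω in A n, (η / n ^ 2) * (∑ k ∈ Finset.range n, U k ω) ^ 4 ∂P + P.real (A n) * (1 / η) +
        ∫ ω in A n, (2 / n) * (∑ k ∈ Finset.range n, W k ω) ^ 2 ∂P := by
        rw [integral_add (hIa.fun_add (integrable_const _)).integrableOn hIw.integrableOn,
          integral_add hIa.integrableOn (integrable_const _), setIntegral_const, smul_eq_mul]
    _ ≤ η / n ^ 2 * (3 * n ^ 2 * (2 * M) ^ 4) + P.real (A n) * (1 / η) +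
        2 / n * (n * (ε / 8)) := by
        have h1 : ∫ ω in A n, (η / n ^ 2) * (∑ k ∈ Finset.range n, U k ω) ^ 4 ∂P ≤
            η / n ^ 2 * (3 * n ^ 2 * (2 * M) ^ 4) := by
          refine (setIntegral_le_integral hIa (Eventually.of_forall fun ω => ?_)).trans ?_
          · simp only [Pi.zero_apply]
            positivity
          · rw [integral_const_mul]
            gcongr
            exact integral_sum_pow_four_le hUm hUind hU0 hUb n
        have h2 : ∫ ω in A n, (2 / n) * (∑ k ∈ Finset.range n, W k ω) ^ 2 ∂P ≤
            2 / n * (n * (ε / 8)) := by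
          refine (setIntegral_le_integral hIw (Eventually.of_forall fun ω => ?_)).trans ?_
          · simp only [Pi.zero_apply]
            positivity
          · rw [integral_const_mul, integral_sum_sq hWL hWind hW0,
              Finset.sum_congr rfl fun k _ => hWsq k, Finset.sum_const, Finset.card_range, nsmul_eq_mul]
            gcongr
        linarith
    _ < ε := by
        have e1 : η / n ^ 2 * (3 * n ^ 2 * (2 * M) ^ 4) = η * (3 * (2 * (M : ℝ)) ^ 4) := by
          field_simp
        have e2 : 2 / n * (n * (ε / 8)) = ε / 4 := by
          field_simp
          norm_num
        have e3 : P.real (A n) * (1 / η) ≤ ε / 8 := by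
          rw [mul_one_div, div_le_iff₀ hηpos]
          linarith
        rw [e1, e2]
        linarith

end Moments

/-! ### The mean distance of the walk from the origin -/

/-- Second-order expansion of the Euclidean norm near `(n m, 0)`: the term `Y ^ 2 / (2 n m)`
approximates the excess of the norm over the first coordinate, with an error controlled by `δ` when
the deviation `(D, Y)` is less than `δ n` in norm and by the squared deviation otherwise. -/
lemma abs_sqrt_expansion_le {m δ n : ℝ} (hm : 0 < m) (hδ : 0 < δ) (hδm : δ ≤ m / 2) (hn : 0 < n)
    (D Y : ℝ) :
    |√((n * m + D) ^ 2 + Y ^ 2) - (n * m + D) - Y ^ 2 / n / (2 * m)| ≤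
      δ / m ^ 2 * (Y ^ 2 / n) +
        if (δ * n) ^ 2 ≤ D ^ 2 + Y ^ 2 then (2 / δ + 1 / (2 * m)) * (D ^ 2 / n + Y ^ 2 / n)
        else 0 := by
  set r := √((n * m + D) ^ 2 + Y ^ 2) with hr
  set g := √(D ^ 2 + Y ^ 2) with hg
  have hr0 : 0 ≤ r := Real.sqrt_nonneg _
  have hg0 : 0 ≤ g := Real.sqrt_nonneg _
  have hr2 : r ^ 2 = (n * m + D) ^ 2 + Y ^ 2 := Real.sq_sqrt (by positivity)
  have hg2 : g ^ 2 = D ^ 2 + Y ^ 2 := Real.sq_sqrt (by positivity)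
  have ht : 0 < n * m := by positivity
  have hD : |D| ≤ g := abs_le_of_sq_le_sq (by nlinarith [sq_nonneg Y]) hg0
  have hD1 := (abs_le.1 hD).1
  have hD2 := (abs_le.1 hD).2
  have hru : r ≤ n * m + g := by
    refine abs_le_of_sq_le_sq' ?_ (by positivity) |>.2
    nlinarith [mul_le_mul_of_nonneg_left hD2 ht.le]
  have hrl : n * m - g ≤ r := by
    refine abs_le_of_sq_le_sq' ?_ hr0 |>.2
    nlinarith [mul_le_mul_of_nonneg_left hD1 ht.le]
  split_ifs with h
  · have hgδ : δ * n ≤ g := Real.le_sqrt_of_sq_le h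
    have h1 : |r - (n * m + D)| ≤ 2 * g := abs_le.2 ⟨by linarith, by linarith⟩
    have h2 : 2 * g ≤ 2 / δ * (D ^ 2 / n + Y ^ 2 / n) := by
      rw [← add_div, ← hg2, div_mul_div_comm, le_div_iff₀ (by positivity)]
      nlinarith
    have h3 : |r - (n * m + D) - Y ^ 2 / n / (2 * m)| ≤
        |r - (n * m + D)| + |Y ^ 2 / n / (2 * m)| := abs_sub _ _
    have h4 : |Y ^ 2 / n / (2 * m)| ≤ 1 / (2 * m) * (D ^ 2 / n + Y ^ 2 / n) := by
      rw [abs_of_nonneg (by positivity), div_eq_mul_inv, mul_comm, one_div]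
      have : 0 ≤ D ^ 2 / n := by positivity
      gcongr
      linarith
    have h5 : 0 ≤ δ / m ^ 2 * (Y ^ 2 / n) := by positivity
    linarith
  · rw [not_le] at h
    have hgδ : g < δ * n := by
      rw [hg, Real.sqrt_lt' (by positivity)]
      exact h
    have hδn : δ * n ≤ n * m / 2 := by nlinarith
    have hsum : n * m ≤ r + (n * m + D) := by linarith
    have hsum0 : 0 < r + (n * m + D) := by linarith
    have hid : r - (n * m + D) - Y ^ 2 / n / (2 * m) =
        Y ^ 2 * (2 * (n * m) - (r + (n * m + D))) / ((r + (n * m + D)) * (2 * (n * m))) := by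
      have h1 : r - (n * m + D) = Y ^ 2 / (r + (n * m + D)) := by
        rw [eq_div_iff hsum0.ne']
        linear_combination hr2
      rw [h1]
      field_simp
    have habs : |2 * (n * m) - (r + (n * m + D))| ≤ 2 * (δ * n) :=
      abs_le.2 ⟨by linarith, by linarith⟩
    rw [hid, abs_div, abs_mul, abs_of_nonneg (sq_nonneg Y),
      abs_of_pos (show 0 < (r + (n * m + D)) * (2 * (n * m)) by positivity), add_zero]
    calc Y ^ 2 * |2 * (n * m) - (r + (n * m + D))| / ((r + (n * m + D)) * (2 * (n * m)))
        ≤ Y ^ 2 * (2 * (δ * n)) / ((n * m) * (2 * (n * m))) := by gcongr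
      _ = _ := by field_simp

section Mean

variable {Ω : Type*} [MeasurableSpace Ω] {P : Measure Ω} [IsProbabilityMeasure P]
  {a b : ℕ → Ω → ℝ}

/-- The mean distance from the origin of a walk with drift `m` along the first axis and centred
fluctuations `a`, `b` along the two axes exceeds `n m` by `E[b ^ 2] / (2 m)` in the limit. -/
theorem tendsto_integral_sqrt {m : ℝ} (hm : 0 < m)
    (ha : ∀ k, Measurable (a k)) (hb : ∀ k, Measurable (b k))
    (haind : iIndepFun a P) (hbind : iIndepFun b P)
    (haid : ∀ k, IdentDistrib (a k) (a 0) P P) (hbid : ∀ k, IdentDistrib (b k) (b 0) P P)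
    (haL : MemLp (a 0) 2 P) (hbL : MemLp (b 0) 2 P)
    (ha0 : ∫ ω, a 0 ω ∂P = 0) (hb0 : ∫ ω, b 0 ω ∂P = 0) :
    Tendsto (fun n : ℕ => ∫ ω, √((n * m + ∑ k ∈ Finset.range n, a k ω) ^ 2 +
      (∑ k ∈ Finset.range n, b k ω) ^ 2) ∂P - n * m) atTop
      (𝓝 ((∫ ω, b 0 ω ^ 2 ∂P) / (2 * m))) := by
  set D : ℕ → Ω → ℝ := fun n ω => ∑ k ∈ Finset.range n, a k ω with hDdef
  set Y : ℕ → Ω → ℝ := fun n ω => ∑ k ∈ Finset.range n, b k ω with hYdef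
  set va := ∫ ω, a 0 ω ^ 2 ∂P with hva
  set vb := ∫ ω, b 0 ω ^ 2 ∂P with hvb
  have haLk : ∀ k, MemLp (a k) 2 P := fun k => (haid k).memLp_iff.2 haL
  have hbLk : ∀ k, MemLp (b k) 2 P := fun k => (hbid k).memLp_iff.2 hbL
  have hDL : ∀ n, MemLp (D n) 2 P := fun n => memLp_finsetSum _ fun k _ => haLk k
  have hYL : ∀ n, MemLp (Y n) 2 P := fun n => memLp_finsetSum _ fun k _ => hbLk k
  have hDm : ∀ n, Measurable (D n) := fun n => Finset.measurable_fun_sum _ fun k _ => ha k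
  have hYm : ∀ n, Measurable (Y n) := fun n => Finset.measurable_fun_sum _ fun k _ => hb k
  have hD0 : ∀ n, ∫ ω, D n ω ∂P = 0 := fun n => by
    simp only [hDdef]
    rw [integral_finsetSum _ fun k _ => (haLk k).integrable one_le_two]
    exact Finset.sum_eq_zero fun k _ => (haid k).integral_eq.trans ha0
  have hD2 : ∀ n : ℕ, ∫ ω, D n ω ^ 2 ∂P = n * va := fun n => by
    simp only [hDdef]
    rw [integral_sum_sq haLk haind fun k => (haid k).integral_eq.trans ha0,
      Finset.sum_congr rfl fun k _ => (haid k).sq.integral_eq]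
    simp [hva]
  have hY2 : ∀ n : ℕ, ∫ ω, Y n ω ^ 2 ∂P = n * vb := fun n => by
    simp only [hYdef]
    rw [integral_sum_sq hbLk hbind fun k => (hbid k).integral_eq.trans hb0,
      Finset.sum_congr rfl fun k _ => (hbid k).sq.integral_eq]
    simp [hvb]
  have hva0 : 0 ≤ va := integral_nonneg fun ω => sq_nonneg _
  have hvb0 : 0 ≤ vb := integral_nonneg fun ω => sq_nonneg _
  have hrI : ∀ n : ℕ, Integrable (fun ω => √((n * m + D n ω) ^ 2 + Y n ω ^ 2)) P := by
    intro n
    have hI : Integrable (fun ω => |n * m| + |D n ω| + |Y n ω|) P :=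
      ((integrable_const _).add ((hDL n).integrable one_le_two).abs).add
        ((hYL n).integrable one_le_two).abs
    refine hI.mono' ?_ (Eventually.of_forall fun ω => ?_)
    · exact ((((hDm n).const_add _).pow_const 2).add
        ((hYm n).pow_const 2)).sqrt.aestronglyMeasurable
    · rw [Real.norm_of_nonneg (Real.sqrt_nonneg _)]
      refine Real.sqrt_le_iff.2 ⟨by positivity, ?_⟩
      have h1 := abs_add_le (n * m) (D n ω)
      have h2 := abs_nonneg (n * m + D n ω)
      have h3 := abs_nonneg (Y n ω)
      rw [← sq_abs (n * m + D n ω), ← sq_abs (Y n ω)]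
      nlinarith
  rw [Metric.tendsto_atTop]
  intro ε hε
  -- The second bound on `δ` makes the error term `δ / m ^ 2 * vb` smaller than `ε / 2`.
  set δ := min (m / 2) (m ^ 2 * ε / (2 * (vb + 1))) with hδdef
  have hδ : 0 < δ := by positivity
  have hδm : δ ≤ m / 2 := min_le_left _ _
  have hδv : δ / m ^ 2 * vb < ε / 2 := by
    have h1 : δ ≤ m ^ 2 * ε / (2 * (vb + 1)) := min_le_right _ _
    have h2 : δ / m ^ 2 ≤ ε / (2 * (vb + 1)) := by
      rw [div_le_iff₀ (by positivity)]
      refine h1.trans (le_of_eq ?_)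
      ring
    calc δ / m ^ 2 * vb ≤ ε / (2 * (vb + 1)) * vb := by gcongr
      _ < ε / 2 := by
        rw [div_mul_eq_mul_div, div_lt_div_iff₀ (by positivity) (by norm_num)]
        nlinarith
  set C := 2 / δ + 1 / (2 * m) with hC
  have hC0 : 0 < C := by positivity
  -- The event of a large deviation.
  set A : ℕ → Set Ω := fun n => {ω | (δ * n) ^ 2 ≤ D n ω ^ 2 + Y n ω ^ 2} with hA
  have hAm : ∀ n, MeasurableSet (A n) := fun n =>
    measurableSet_le measurable_const (((hDm n).pow_const 2).add ((hYm n).pow_const 2))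
  have hPA : Tendsto (fun n => P.real (A n)) atTop (𝓝 0) := by
    have hlim : Tendsto (fun n : ℕ => (va + vb) / δ ^ 2 / (n : ℝ)) atTop (𝓝 0) :=
      tendsto_const_div_atTop_nhds_zero_nat _
    refine squeeze_zero' (Eventually.of_forall fun n => measureReal_nonneg) ?_ hlim
    filter_upwards [eventually_gt_atTop 0] with n hn
    have hn' : (0 : ℝ) < n := by exact_mod_cast hn
    have h := mul_meas_ge_le_integral_of_nonneg (μ := P) (f := fun ω => D n ω ^ 2 + Y n ω ^ 2)
      (Eventually.of_forall fun ω => by positivity)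
      ((hDL n).integrable_sq.add (hYL n).integrable_sq) ((δ * n) ^ 2)
    rw [integral_add (hDL n).integrable_sq (hYL n).integrable_sq, hD2, hY2] at h
    rw [div_div, le_div_iff₀ (by positivity)]
    have h' : (n : ℝ) * (P.real (A n) * (δ ^ 2 * n)) ≤ n * (va + vb) := by
      calc (n : ℝ) * (P.real (A n) * (δ ^ 2 * n)) = (δ * n) ^ 2 * P.real (A n) := by ring
        _ ≤ _ := h
        _ = _ := by ring
    exact le_of_mul_le_mul_left h' hn'
  have huD := tendsto_setIntegral_sum_sq ha haind haid haL ha0 hPA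
  have huY := tendsto_setIntegral_sum_sq hb hbind hbid hbL hb0 hPA
  have hu := (huD.add huY).const_mul C
  rw [add_zero, mul_zero] at hu
  obtain ⟨N, hN⟩ := eventually_atTop.1 (hu.eventually_lt_const (half_pos hε))
  refine ⟨max N 1, fun n hn => ?_⟩
  have hn1 : (0 : ℝ) < n := by exact_mod_cast (le_max_right N 1).trans hn
  have hNn := hN n ((le_max_left N 1).trans hn)
  have hYn : Integrable (fun ω => Y n ω ^ 2 / n) P := (hYL n).integrable_sq.div_const _
  have hDn : Integrable (fun ω => D n ω ^ 2 / n) P := (hDL n).integrable_sq.div_const _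
  have hYint : ∫ ω, Y n ω ^ 2 / n ∂P = vb := by
    rw [integral_div, hY2]
    field_simp
  have hXI : Integrable (fun ω => n * m + D n ω) P :=
    (integrable_const _).add ((hDL n).integrable one_le_two)
  have hrX : Integrable (fun ω => √((n * m + D n ω) ^ 2 + Y n ω ^ 2) - (n * m + D n ω)) P :=
    (hrI n).sub hXI
  have hkey : ∫ ω, √((n * m + D n ω) ^ 2 + Y n ω ^ 2) ∂P - n * m - vb / (2 * m) =
      ∫ ω, (√((n * m + D n ω) ^ 2 + Y n ω ^ 2) - (n * m + D n ω) -
        Y n ω ^ 2 / n / (2 * m)) ∂P := by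
    rw [integral_sub hrX (hYn.div_const _), integral_sub (hrI n) hXI,
      integral_add (integrable_const _) ((hDL n).integrable one_le_two), hD0, integral_div, hYint]
    simp
  have hind : Integrable ((A n).indicator fun ω => C * (D n ω ^ 2 / n + Y n ω ^ 2 / n)) P :=
    ((hDn.add hYn).const_mul C).indicator (hAm n)
  rw [Real.dist_eq, hkey]
  calc |∫ ω, (√((n * m + D n ω) ^ 2 + Y n ω ^ 2) - (n * m + D n ω) -
        Y n ω ^ 2 / n / (2 * m)) ∂P|
      ≤ ∫ ω, |√((n * m + D n ω) ^ 2 + Y n ω ^ 2) - (n * m + D n ω) -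
        Y n ω ^ 2 / n / (2 * m)| ∂P := abs_integral_le_integral_abs
    _ ≤ ∫ ω, (δ / m ^ 2 * (Y n ω ^ 2 / n) +
        (A n).indicator (fun ω => C * (D n ω ^ 2 / n + Y n ω ^ 2 / n)) ω) ∂P := by
        refine integral_mono ((hrX.sub (hYn.div_const _)).abs) ((hYn.const_mul _).add hind)
          fun ω => ?_
        exact abs_sqrt_expansion_le hm hδ hδm hn1 (D n ω) (Y n ω)
    _ = δ / m ^ 2 * vb + C * (∫ ω in A n, D n ω ^ 2 / n ∂P + ∫ ω in A n, Y n ω ^ 2 / n ∂P) := by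
        rw [integral_add (hYn.const_mul _) hind, integral_const_mul, hYint,
          integral_indicator (hAm n), integral_const_mul,
          integral_add hDn.integrableOn hYn.integrableOn]
    _ < ε := by linarith

end Mean

lemma norm_sq_eq_inner_dir (x : Plane) (φ : ℝ) :
    ‖x‖ ^ 2 = inner ℝ x (dir φ) ^ 2 + inner ℝ x (dir (φ + Real.pi / 2)) ^ 2 := by
  rw [EuclideanSpace.norm_sq_eq, Fin.sum_univ_two, inner_dir, inner_dir, Real.cos_add_pi_div_two,
    Real.sin_add_pi_div_two, Real.norm_eq_abs, Real.norm_eq_abs, sq_abs, sq_abs]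
  linear_combination (-(x 0 ^ 2 + x 1 ^ 2)) * Real.sin_sq_add_cos_sq φ

lemma inner_dir_self (φ : ℝ) : inner ℝ (dir φ) (dir φ) = 1 := by
  rw [real_inner_self_eq_norm_sq, norm_dir, one_pow]

lemma inner_dir_perp (φ : ℝ) : inner ℝ (dir φ) (dir (φ + Real.pi / 2)) = 0 := by
  rw [inner_dir, Real.cos_add_pi_div_two, Real.sin_add_pi_div_two]
  simp [dir]
  ring

section Asymptotics

variable {Ω : Type*} [MeasurableSpace Ω] {P : Measure Ω} [IsProbabilityMeasure P]
  {ξ : Ω → Plane} {Z : ℕ → Ω → Plane}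

/-- The variance orthogonal to the drift is the second moment of the component in that direction. -/
lemma perpVariance_eq (hL : MemLp ξ 2 P) (hdrift : ∫ ω, ξ ω ∂P ≠ 0) {φ : ℝ}
    (hφ : ∫ ω, ξ ω ∂P = ‖∫ ω, ξ ω ∂P‖ • dir φ) :
    perpVariance P ξ = ∫ ω, inner ℝ (ξ ω) (dir (φ + Real.pi / 2)) ^ 2 ∂P := by
  set μ := ∫ ω, ξ ω ∂P with hμ
  have hu : ‖μ‖⁻¹ • μ = dir φ := by
    conv_lhs => rw [hφ]
    rw [norm_smul, norm_dir, mul_one, norm_norm, smul_smul,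
      inv_mul_cancel₀ (norm_ne_zero_iff.2 hdrift), one_smul]
  have hperp : inner ℝ μ (dir (φ + Real.pi / 2)) = 0 := by
    rw [hφ, real_inner_smul_left, inner_dir_perp, mul_zero]
  have hLc : ∀ e : Plane, Integrable (fun ω => inner ℝ (ξ ω - μ) e ^ 2) P := fun e =>
    ((hL.sub (memLp_const μ)).inner_const e).integrable_sq
  rw [perpVariance, totalVariance, parallelVariance, ← hμ, hu]
  simp_rw [norm_sq_eq_inner_dir _ φ]
  rw [integral_add (hLc _) (hLc _), add_sub_cancel_left]
  simp_rw [inner_sub_left, hperp, sub_zero]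

/-- The mean distance from the origin of a planar walk with nonzero drift. -/
theorem tendsto_integral_norm_walk (hZ : ∀ k, Measurable (Z k)) (hindep : iIndepFun Z P)
    (hident : ∀ k, IdentDistrib (Z k) ξ P P) (hL : MemLp ξ 2 P) (hdrift : ∫ ω, ξ ω ∂P ≠ 0) :
    Tendsto (fun n : ℕ => ∫ ω, ‖walk Z n ω‖ ∂P - n * ‖∫ ω, ξ ω ∂P‖) atTop
      (𝓝 (perpVariance P ξ / (2 * ‖∫ ω, ξ ω ∂P‖))) := by
  obtain ⟨φ, hφ⟩ := exists_eq_norm_smul_dir (∫ ω, ξ ω ∂P)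
  set m := ‖∫ ω, ξ ω ∂P‖ with hm
  have hmean : ∀ e : Plane, ∫ ω, inner ℝ (ξ ω) e ∂P = inner ℝ (∫ ω, ξ ω ∂P) e := fun e => by
    simp_rw [real_inner_comm e]
    exact integral_inner (hL.integrable one_le_two) e
  have hga : Measurable fun x : Plane => inner ℝ x (dir φ) - m := by fun_prop
  have hgb : Measurable fun x : Plane => inner ℝ x (dir (φ + Real.pi / 2)) := by fun_prop
  have h := tendsto_integral_sqrt (P := P) (a := fun k ω => inner ℝ (Z k ω) (dir φ) - m)
    (b := fun k ω => inner ℝ (Z k ω) (dir (φ + Real.pi / 2))) (m := m) (norm_pos_iff.2 hdrift)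
    (fun k => hga.comp (hZ k)) (fun k => hgb.comp (hZ k))
    (hindep.comp (fun _ x => inner ℝ x (dir φ) - m) fun _ => hga)
    (hindep.comp (fun _ x => inner ℝ x (dir (φ + Real.pi / 2))) fun _ => hgb)
    (fun k => ((hident k).trans (hident 0).symm).comp hga)
    (fun k => ((hident k).trans (hident 0).symm).comp hgb)
    ((((hident 0).memLp_iff.2 hL).inner_const _).sub (memLp_const m))
    (((hident 0).memLp_iff.2 hL).inner_const _) ?_ ?_
  · have hv : ∫ ω, inner ℝ (Z 0 ω) (dir (φ + Real.pi / 2)) ^ 2 ∂P =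
        ∫ ω, inner ℝ (ξ ω) (dir (φ + Real.pi / 2)) ^ 2 ∂P :=
      ((hident 0).comp (hgb.pow_const 2)).integral_eq
    rw [perpVariance_eq hL hdrift hφ, ← hv]
    refine h.congr fun n => ?_
    congr 1
    refine integral_congr_ae (Eventually.of_forall fun ω => ?_)
    simp only
    rw [← Real.sqrt_sq (norm_nonneg (walk Z n ω)), norm_sq_eq_inner_dir _ φ]
    simp [walk, sum_inner, Finset.sum_sub_distrib]
  · refine (((hident 0).comp hga).integral_eq).trans ?_
    simp only [Function.comp_def]
    rw [integral_sub ((hL.inner_const _).integrable one_le_two) (integrable_const m), hmean, hφ,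
      real_inner_smul_left, inner_dir_self]
    simp
  · refine (((hident 0).comp hgb).integral_eq).trans ?_
    simp only [Function.comp_def]
    rw [hmean, hφ, real_inner_smul_left, inner_dir_perp, mul_zero]

end Asymptotics

/-- Logarithmic averages: if `g` tends to `0`, then `∑ (c + g (k + 1)) / (k + 1)` is
`(c + o(1)) log n`. -/
lemma tendsto_sum_div_log {g : ℕ → ℝ} (hg : Tendsto g atTop (𝓝 0)) (c : ℝ) :
    Tendsto (fun n : ℕ => (∑ k ∈ Finset.range n, (c + g (k + 1)) / (k + 1 : ℝ)) / Real.log n)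
      atTop (𝓝 c) := by
  have hlog : Tendsto (fun n : ℕ => Real.log n) atTop atTop :=
    Real.tendsto_log_atTop.comp tendsto_natCast_atTop_atTop
  have hH : ∀ n : ℕ, (harmonic n : ℝ) = ∑ k ∈ Finset.range n, 1 / (k + 1 : ℝ) := fun n => by
    simp [harmonic]
  have hHlog : Tendsto (fun n : ℕ => (harmonic n : ℝ) / Real.log n) atTop (𝓝 1) := by
    have h1 := (Real.tendsto_harmonic_sub_log.div_atTop hlog).add_const 1
    rw [zero_add] at h1
    refine h1.congr' ?_
    filter_upwards [hlog.eventually_gt_atTop 0] with n hn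
    rw [sub_div, div_self hn.ne']
    ring
  have hHtop : Tendsto (fun n : ℕ => ∑ k ∈ Finset.range n, 1 / (k + 1 : ℝ)) atTop atTop :=
    Real.tendsto_sum_range_one_div_nat_succ_atTop
  have ho : (fun k : ℕ => g (k + 1) / (k + 1 : ℝ)) =o[atTop] fun k : ℕ => 1 / (k + 1 : ℝ) := by
    have hg1 : (fun k : ℕ => g (k + 1)) =o[atTop] fun _ => (1 : ℝ) :=
      (Asymptotics.isLittleO_one_iff ℝ).2 (hg.comp (tendsto_add_atTop_nat 1))
    simpa [div_eq_mul_inv] using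
      hg1.mul_isBigO (Asymptotics.isBigO_refl (fun k : ℕ => ((k : ℝ) + 1)⁻¹) atTop)
  have hS := ho.sum_range (fun k => by positivity) hHtop
  have hlim := (hHlog.const_mul c).add ((hS.tendsto_div_nhds_zero).mul hHlog)
  rw [mul_one, zero_mul, add_zero] at hlim
  refine hlim.congr' ?_
  filter_upwards [hHtop.eventually_gt_atTop 0] with n hn
  rw [hH, div_mul_div_cancel₀ hn.ne', ← mul_div_assoc, ← add_div, Finset.mul_sum,
    ← Finset.sum_add_distrib]
  congr 1
  refine Finset.sum_congr rfl fun k _ => ?_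
  ring

end PlanarWalk

theorem mainTheorem7 {Ω : Type*} [MeasurableSpace Ω] (P : Measure Ω) [IsProbabilityMeasure P]
    (ξ : Ω → PlanarWalk.Plane) (Z : ℕ → Ω → PlanarWalk.Plane)
    (hξ : Measurable ξ) (hZ : ∀ k, Measurable (Z k))
    (hindep : iIndepFun Z P) (hident : ∀ k, IdentDistrib (Z k) ξ P P)
    (hsq : Integrable (fun ω => ‖ξ ω‖ ^ 2) P)
    (hdrift : ∫ ω, ξ ω ∂P ≠ 0) :
    (∀ n : ℕ, Integrable (PlanarWalk.perimeterLength Z n) P) ∧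
    ∃ r : ℕ → ℝ, Tendsto r atTop (𝓝 0) ∧ ∀ n : ℕ, 2 ≤ n →
      ∫ ω, PlanarWalk.perimeterLength Z n ω ∂P =
        2 * ‖∫ ω, ξ ω ∂P‖ * n +
          (PlanarWalk.perpVariance P ξ / ‖∫ ω, ξ ω ∂P‖ + r n) * Real.log n := by
  have hL := (memLp_two_iff_integrable_sq_norm hξ.aestronglyMeasurable).2 hsq
  have hint : ∀ k, Integrable (Z k) P := fun k =>
    (hident k).integrable_iff.2 (hL.integrable one_le_two)
  have hid : ∀ k, P.map (Z k) = P.map (Z 0) := fun k =>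
    ((hident k).trans (hident 0).symm).map_eq
  have hlen : ∀ n, PlanarWalk.perimeterLength Z n =
      fun ω => PlanarWalk.len (fun k => Z k ω) n := fun n =>
    funext (PlanarWalk.perimeterLength_eq_len Z n)
  refine ⟨fun n => ?_, ?_⟩
  · rw [hlen]
    exact PlanarWalk.integrable_len hZ hint id n
  set m := ‖∫ ω, ξ ω ∂P‖ with hm
  have hm0 : m ≠ 0 := norm_ne_zero_iff.2 hdrift
  set c := PlanarWalk.perpVariance P ξ / m with hc
  set g : ℕ → ℝ := fun n => 2 * (∫ ω, ‖PlanarWalk.walk Z n ω‖ ∂P - n * m) - c with hg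
  have hg0 : Tendsto g atTop (𝓝 0) := by
    have h := ((PlanarWalk.tendsto_integral_norm_walk hZ hindep hident hL hdrift).const_mul
      2).sub_const c
    have hz : 2 * (PlanarWalk.perpVariance P ξ / (2 * m)) - c = 0 := by
      rw [hc]
      field_simp
      ring
    rw [← hm, hz] at h
    exact h
  have hsum : ∀ n : ℕ, ∫ ω, PlanarWalk.perimeterLength Z n ω ∂P = 2 * m * n +
      ∑ k ∈ Finset.range n, (c + g (k + 1)) / (k + 1 : ℝ) := by
    intro n
    rw [hlen, PlanarWalk.integral_len_eq_sum hZ hint hindep hid,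
      show 2 * m * (n : ℝ) = ∑ _k ∈ Finset.range n, 2 * m by simp [mul_comm],
      ← Finset.sum_add_distrib]
    refine Finset.sum_congr rfl fun k _ => ?_
    have hk : (k + 1 : ℝ) ≠ 0 := by positivity
    simp only [hg]
    push_cast
    field_simp
    ring
  refine ⟨fun n => (∑ k ∈ Finset.range n, (c + g (k + 1)) / (k + 1 : ℝ)) / Real.log n - c, ?_, ?_⟩
  · simpa using (PlanarWalk.tendsto_sum_div_log hg0 c).sub_const c
  · intro n hn
    have hlog : Real.log n ≠ 0 := (Real.log_pos (by exact_mod_cast hn)).ne'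
    rw [hsum, add_sub_cancel, div_mul_cancel₀ _ hlog]
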